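/- Let $(L,\omega)$ be a marked link: $L\subset S^3$ is a link and $\omega\subset S^3$ is a compact one-dimensional submanifold with $\partial\omega\subset L$ and interior disjoint from $L$ (arcs with both ends on $L$, and closed curves). Let $S^1_A=\{e^{I\theta}\}$ and $S^1_B=\{Je^{I\theta}\}$ in the unit quaternions and let $BD=S^1_A\cup S^1_B$ be the binary dihedral group. Let $R_B(L,\omega)$ be the set of homomorphisms $\rho:\pi_1(S^3\setminus(L\cup\omega))\to BD$ with $\rho(\mu)\in S^1_B$ for every meridian $\mu$ of $L$ and $\rho(\mu)=-1$ for every meridian $\mu$ of $\omega$, modulo conjugation by elements of $S^1_A$ (conjugation shifts all angles $\theta$ of the images $Je^{I\theta}$ of the meridians of $L$ by a common constant). Here marked links are given by planar diagrams of $L\cup\omega$, and $\pi_1(S^3\setminus(L\cup\omega))$ by the Wirtinger presentation of the diagram: the generators are the meridians of the edges, reversing an edge inverts its meridian, and at each crossing and at each end point of $\omega$ the usual relations hold. The determinant $\det(L)\ge 0$ is the greatest common divisor of the minors of size $n-1$ of the coloring matrix of a diagram of $L$ with $n$ arcs, whose row for a crossing has $1$ for each of the two arcs that end at the crossing, $-2$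 for the arc that passes over, and $0$ elsewhere (coinciding entries are added). Theorem. Let $L$ be a link with $\det(L)\neq 0$. Then $R_B(L,\omega)$ is finite for every marking $\omega$, and its cardinality does not depend on $\omega$: for any two markings $\omega,\omega'$ of $L$, drawn on the same diagram of $L$, we have $|R_B(L,\omega)|=|R_B(L,\omega')|$. -/

import Mathlib

open scoped Quaternion

/-- A diagram on an oriented sphere of a link `L` together with a compact one-dimensional
submanifold `ω` with `∂ω ⊆ L` (arcs with both ends on `L`, and closed curves), whose interior is
disjoint from `L`.  The underlying graph is encoded by its half-edges ("darts"), each regarded as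
pointing out of its vertex: `edge` exchanges the two halves of an edge, and `rot` rotates
counterclockwise to the next dart at the same vertex.  The vertices are
* crossings (four darts), with over/under information; each strand of a crossing may belong to `L`
  or to `ω`;
* end points of `ω` (three darts, two in `L` and one in `ω`);
* subdivision points (two darts), which carry no information; they may be put anywhere, and they
  allow for closed curves without crossings.

The value of `isOver` matters at crossings only. -/
structure MarkedLinkDiagram where
  Dart : Type
  finite_dart : Finite Dart
  edge : Equiv.Perm Dart
  edge_edge : ∀ d, edge (edge d) = d
  edge_ne : ∀ d, edge d ≠ d
  rot : Equiv.Perm Dart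
  /-- The dart belongs to `L`; otherwise it belongs to `ω`. -/
  isLink : Dart → Prop
  /-- The dart belongs to the upper strand of its crossing. -/
  isOver : Dart → Prop
  isLink_edge : ∀ d, isLink (edge d) ↔ isLink d
  vertex_cases : ∀ d,
    -- subdivision point
    (rot d ≠ d ∧ rot (rot d) = d ∧ (isLink (rot d) ↔ isLink d)) ∨
    -- end point of `ω`
    (rot d ≠ d ∧ rot (rot (rot d)) = d ∧
      ((¬ isLink d ∧ isLink (rot d) ∧ isLink (rot (rot d))) ∨
       (isLink d ∧ ¬ isLink (rot d) ∧ isLink (rot (rot d))) ∨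
       (isLink d ∧ isLink (rot d) ∧ ¬ isLink (rot (rot d))))) ∨
    -- crossing
    (rot (rot d) ≠ d ∧ rot (rot (rot (rot d))) = d ∧ (isLink (rot (rot d)) ↔ isLink d) ∧
      (isOver (rot d) ↔ ¬ isOver d))

namespace MarkedLinkDiagram

variable (D : MarkedLinkDiagram)

instance : Finite D.Dart := D.finite_dart

/-- The vertex of `d` has two darts. -/
def IsSubdivision (d : D.Dart) : Prop := D.rot d ≠ d ∧ D.rot (D.rot d) = d

/-- The vertex of `d` has three darts. -/
def IsEndpoint (d : D.Dart) : Prop := D.rot d ≠ d ∧ D.rot (D.rot (D.rot d)) = d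

/-- The vertex of `d` has four darts. -/
def IsCrossing (d : D.Dart) : Prop :=
  D.rot (D.rot d) ≠ d ∧ D.rot (D.rot (D.rot (D.rot d))) = d

/-! ### Planarity -/

/-- Vertices are the cycles of `rot`. -/
abbrev Vertex : Type := Quotient (Equiv.Perm.SameCycle.setoid D.rot)

/-- Edges are the cycles of `edge`. -/
abbrev Edge : Type := Quotient (Equiv.Perm.SameCycle.setoid D.edge)

/-- Faces are the cycles of `rot ∘ edge`. -/
abbrev Face : Type := Quotient (Equiv.Perm.SameCycle.setoid (D.rot * D.edge))

/-- Connected components of the underlying four-, three- and two-valent graph. -/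
abbrev Piece : Type :=
  MulAction.orbitRel.Quotient (Subgroup.closure {D.rot, D.edge}) D.Dart

/-- The diagram lies on a sphere: `V - E + F = 2` for each connected component of the graph.
As `V - E + F ≤ 2` always holds for a component, the sum over the components says the same. -/
def IsPlanar : Prop :=
  Nat.card D.Vertex + Nat.card D.Face = Nat.card D.Edge + 2 * Nat.card D.Piece

/-! ### The underlying link -/

theorem isLink_rot_rot {d : D.Dart} (h : D.isLink d) (h' : ¬ D.isLink (D.rot d)) :
    D.isLink (D.rot (D.rot d)) := by
  rcases D.vertex_cases d with ⟨_, _, h1⟩ | ⟨_, _, h1⟩ | ⟨_, _, h1, _⟩ <;> tauto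

open Classical in
/-- The next dart of `L`, counterclockwise around the vertex. -/
noncomputable def linkRotFun (d : {d : D.Dart // D.isLink d}) : {d : D.Dart // D.isLink d} :=
  if h : D.isLink (D.rot d) then ⟨D.rot d, h⟩
  else ⟨D.rot (D.rot d), D.isLink_rot_rot d.2 h⟩

theorem linkRotFun_injective : Function.Injective D.linkRotFun := by
  rintro ⟨a, ha⟩ ⟨b, hb⟩ hab
  unfold linkRotFun at hab
  by_cases h1 : D.isLink (D.rot a) <;> by_cases h2 : D.isLink (D.rot b) <;>
    simp only [h1, h2, dite_true, dite_false, Subtype.mk.injEq, EmbeddingLike.apply_eq_iff_eq]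
      at hab
  · exact Subtype.ext hab
  · exact absurd (hab ▸ ha) h2
  · exact absurd (hab ▸ hb) h1
  · exact Subtype.ext hab

/-- The rotation of the darts of `L` around their vertices, when `ω` is erased. -/
noncomputable def linkRot : Equiv.Perm {d : D.Dart // D.isLink d} :=
  Equiv.ofBijective D.linkRotFun (Finite.injective_iff_bijective.mp D.linkRotFun_injective)

theorem linkRot_of_isLink (d : {d : D.Dart // D.isLink d}) (h : D.isLink (D.rot d)) :
    D.linkRot d = ⟨D.rot d, h⟩ := by
  simp [linkRot, linkRotFun, h]

theorem linkRot_of_not_isLink (d : {d : D.Dart // D.isLink d}) (h : ¬ D.isLink (D.rot d)) :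
    D.linkRot d = ⟨D.rot (D.rot d), D.isLink_rot_rot d.2 h⟩ := by
  simp [linkRot, linkRotFun, h]

/-- The involution of the darts of `L` given by its edges. -/
def linkEdge : Equiv.Perm {d : D.Dart // D.isLink d} :=
  D.edge.subtypePerm fun d => D.isLink_edge d

theorem isLink_rot_three {d : D.Dart} (h : D.IsCrossing d) (h' : D.isLink (D.rot d)) :
    D.isLink (D.rot (D.rot (D.rot d))) := by
  obtain ⟨h2, h4⟩ := h
  rcases D.vertex_cases (D.rot d) with ⟨_, h3, _⟩ | ⟨_, h3, _⟩ | ⟨_, _, h3, _⟩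
  · exact absurd (D.rot.injective h3) h2
  · rw [h4] at h3
    exact absurd (by rw [← h3, ← h3]) h2
  · exact h3.mpr h'

theorem erase_vertex_cases (d : {d : D.Dart // D.isLink d}) :
    (D.linkRot d ≠ d ∧ D.linkRot (D.linkRot d) = d ∧ (True ↔ True)) ∨
    (D.linkRot d ≠ d ∧ D.linkRot (D.linkRot (D.linkRot d)) = d ∧
      ((¬ True ∧ True ∧ True) ∨ (True ∧ ¬ True ∧ True) ∨ (True ∧ True ∧ ¬ True))) ∨
    (D.linkRot (D.linkRot d) ≠ d ∧ D.linkRot (D.linkRot (D.linkRot (D.linkRot d))) = d ∧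
      (True ↔ True) ∧ (D.isOver (D.linkRot d) ↔ ¬ D.isOver d)) := by
  obtain ⟨d, hd⟩ := d
  rcases D.vertex_cases d with ⟨h1, h2, h3⟩ | ⟨h1, h3, h⟩ | ⟨h2, h4, h, ho⟩
  · left
    have e1 := D.linkRot_of_isLink ⟨d, hd⟩ (h3.mpr hd)
    have e2 := D.linkRot_of_isLink ⟨D.rot d, h3.mpr hd⟩ (by rw [h2]; exact hd)
    rw [e1, e2]
    simp [h1, h2]
  · left
    have h2 : D.rot (D.rot d) ≠ d := fun h2 => h1 (by rw [h2] at h3; exact h3)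
    by_cases hr : D.isLink (D.rot d)
    · have hr' : ¬ D.isLink (D.rot (D.rot d)) := by tauto
      have e1 := D.linkRot_of_isLink ⟨d, hd⟩ hr
      have e2 := D.linkRot_of_not_isLink ⟨D.rot d, hr⟩ hr'
      rw [e1, e2]
      simp [h1, h3]
    · have hr' := D.isLink_rot_rot hd hr
      have e1 := D.linkRot_of_not_isLink ⟨d, hd⟩ hr
      have e2 := D.linkRot_of_isLink ⟨D.rot (D.rot d), hr'⟩ (by rw [h3]; exact hd)
      rw [e1, e2]
      simp [h2, h3]
  · by_cases hr : D.isLink (D.rot d)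
    · right; right
      have h3 := D.isLink_rot_three ⟨h2, h4⟩ hr
      have e1 := D.linkRot_of_isLink ⟨d, hd⟩ hr
      have e2 := D.linkRot_of_isLink ⟨D.rot d, hr⟩ (h.mpr hd)
      have e3 := D.linkRot_of_isLink ⟨D.rot (D.rot d), h.mpr hd⟩ h3
      have e4 := D.linkRot_of_isLink ⟨D.rot (D.rot (D.rot d)), h3⟩ (by rw [h4]; exact hd)
      rw [e1, e2, e3, e4]
      simp [h2, h4, ho]
    · left
      have hn : ¬ D.isLink (D.rot (D.rot (D.rot d))) := fun h3 => by
        rcases D.vertex_cases (D.rot d) with ⟨_, h5, _⟩ | ⟨_, h5, _⟩ | ⟨_, _, h5, _⟩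
        · exact h2 (D.rot.injective h5)
        · rw [h4] at h5
          exact h2 (by rw [← h5, ← h5])
        · exact hr (h5.mp h3)
      have e1 := D.linkRot_of_not_isLink ⟨d, hd⟩ hr
      have e2 := D.linkRot_of_not_isLink ⟨D.rot (D.rot d), h.mpr hd⟩ hn
      rw [e1, e2]
      simp [h2, h4]

/-- The diagram of `L` (with empty marking) that is left when `ω` is erased.  Crossings of `L` with
`ω` and end points of `ω` become subdivision points. -/
noncomputable def erase : MarkedLinkDiagram where
  Dart := {d : D.Dart // D.isLink d}
  finite_dart := inferInstance
  edge := D.linkEdge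
  edge_edge d := Subtype.ext (D.edge_edge d)
  edge_ne d h := D.edge_ne d (congrArg Subtype.val h)
  rot := D.linkRot
  isLink _ := True
  isOver d := D.isOver d
  isLink_edge _ := Iff.rfl
  vertex_cases d := D.erase_vertex_cases d

/-- Two diagrams agree up to an orientation preserving homeomorphism of the sphere. -/
structure Iso (D D' : MarkedLinkDiagram) where
  toEquiv : D.Dart ≃ D'.Dart
  map_edge : ∀ d, toEquiv (D.edge d) = D'.edge (toEquiv d)
  map_rot : ∀ d, toEquiv (D.rot d) = D'.rot (toEquiv d)
  map_isLink : ∀ d, D'.isLink (toEquiv d) ↔ D.isLink d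
  map_isOver : ∀ d, D.IsCrossing d → (D'.isOver (toEquiv d) ↔ D.isOver d)

/-! ### The determinant of a link -/

/-- Two darts are consecutive on an arc: they form an edge, or they are joined through a subdivision
point or along the upper strand of a crossing. -/
inductive ArcStep : D.Dart → D.Dart → Prop
  | edge (d : D.Dart) : ArcStep d (D.edge d)
  | subdivision (d : D.Dart) (h : D.IsSubdivision d) : ArcStep d (D.rot d)
  | over (d : D.Dart) (h : D.IsCrossing d) (ho : D.isOver d) : ArcStep d (D.rot (D.rot d))

/-- The arcs of a link diagram: the pieces into which the link is cut at the undercrossings. -/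
abbrev Arc : Type := Quotient (Relation.EqvGen.setoid D.ArcStep)

/-- The arc that contains a dart. -/
def arc (d : D.Dart) : D.Arc := Quotient.mk _ d

/-- The vertex of a dart. -/
def vertex (d : D.Dart) : D.Vertex := Quotient.mk _ d

/-- The crossings of a diagram. -/
abbrev Crossing : Type := {v : D.Vertex // ∃ d, D.IsCrossing d ∧ D.vertex d = v}

/-- The coloring matrix of a link diagram: the row of a crossing has a `1` for each of the two arcs
that end there and a `-2` for the arc that passes over (entries are added if some of these arcs
coincide).  The upper strand has two darts at the crossing, each of which contributes `-1`. -/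
noncomputable def coloringMatrix : Matrix D.Crossing D.Arc ℤ := fun c a =>
  (Nat.card {d : D.Dart // D.vertex d = c ∧ D.arc d = a ∧ ¬ D.isOver d} : ℤ) -
    (Nat.card {d : D.Dart // D.vertex d = c ∧ D.arc d = a ∧ D.isOver d} : ℤ)

/-- The determinant of the link with a given diagram (with empty marking): with `n` the number of
arcs, the greatest common divisor of the minors of size `n - 1` of the coloring matrix.  (All minors
of a square coloring matrix obtained by deleting one row and one column agree up to sign.) -/
noncomputable def determinant : ℕ :=
  letI := Fintype.ofFinite ((Fin (Nat.card D.Arc - 1) → D.Crossing) ×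
    (Fin (Nat.card D.Arc - 1) → D.Arc))
  Finset.univ.gcd fun p : (Fin (Nat.card D.Arc - 1) → D.Crossing) ×
      (Fin (Nat.card D.Arc - 1) → D.Arc) =>
    (D.coloringMatrix.submatrix p.1 p.2).det.natAbs

/-! ### The fundamental group of the complement -/

/-- The relators of the Wirtinger presentation of `π₁(S³ ∖ (L ∪ ω))`, based above the diagram.  The
generator of a dart `d` is its meridian: the loop that passes below the edge of `d` from the right
to the left of `d`, for `d` pointing out of its vertex; products of loops are traversed from left to
right. -/
inductive Relator : FreeGroup D.Dart → Prop
  /-- The two directions of an edge have inverse meridians. -/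
  | edge (d : D.Dart) : Relator (.of d * .of (D.edge d))
  | subdivision (d : D.Dart) (h : D.IsSubdivision d) : Relator (.of d * .of (D.rot d))
  /-- A loop that passes below all the edges at an end point of `ω` is trivial. -/
  | endpoint (d : D.Dart) (h : D.IsEndpoint d) :
      Relator (.of d * .of (D.rot d) * .of (D.rot (D.rot d)))
  /-- The meridian of the upper strand does not change at a crossing. -/
  | over (d : D.Dart) (h : D.IsCrossing d) (ho : D.isOver d) :
      Relator (.of d * .of (D.rot (D.rot d)))
  /-- A loop that passes below all the edges at a crossing is trivial; together with the previous
  relator this conjugates the meridian of the lower strand by that of the upper one. -/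
  | crossing (d : D.Dart) (h : D.IsCrossing d) :
      Relator (.of d * .of (D.rot d) * .of (D.rot (D.rot d)) * .of (D.rot (D.rot (D.rot d))))

/-- The fundamental group of the complement of `L ∪ ω`. -/
abbrev ComplementGroup : Type := PresentedGroup {r | D.Relator r}

/-- The meridian of a dart. -/
def meridian (d : D.Dart) : D.ComplementGroup := PresentedGroup.of d

end MarkedLinkDiagram

/-! ### The binary dihedral group -/

/-- The quaternion `e^{Iθ} = cos θ + I sin θ`. -/
noncomputable def quatExpI (θ : ℝ) : ℍ[ℝ] := ⟨Real.cos θ, Real.sin θ, 0, 0⟩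

/-- The quaternion `J`. -/
def quatJ : ℍ[ℝ] := ⟨0, 0, 1, 0⟩

/-- The circle `S¹_A` of the quaternions `e^{Iθ}`. -/
def circleA : Set ℍ[ℝ] := {q | ∃ θ : ℝ, q = quatExpI θ}

/-- The circle `S¹_B` of the quaternions `J e^{Iθ}`. -/
def circleB : Set ℍ[ℝ] := {q | ∃ θ : ℝ, q = quatJ * quatExpI θ}

theorem quatExpI_mul (a b : ℝ) : quatExpI a * quatExpI b = quatExpI (a + b) := by
  ext
  · rw [Quaternion.re_mul]; simp [quatExpI, Real.cos_add]
  · rw [Quaternion.imI_mul]; simp [quatExpI, Real.sin_add]; ring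
  · rw [Quaternion.imJ_mul]; simp [quatExpI]
  · rw [Quaternion.imK_mul]; simp [quatExpI]

theorem quatExpI_mul_quatJ (a : ℝ) : quatExpI a * quatJ = quatJ * quatExpI (-a) := by
  ext
  · rw [Quaternion.re_mul, Quaternion.re_mul]; simp [quatExpI, quatJ]
  · rw [Quaternion.imI_mul, Quaternion.imI_mul]; simp [quatExpI, quatJ]
  · rw [Quaternion.imJ_mul, Quaternion.imJ_mul]; simp [quatExpI, quatJ]
  · rw [Quaternion.imK_mul, Quaternion.imK_mul]; simp [quatExpI, quatJ]

theorem quatJ_mul_quatJ : quatJ * quatJ = quatExpI Real.pi := by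
  ext
  · rw [Quaternion.re_mul]; simp [quatExpI, quatJ]
  · rw [Quaternion.imI_mul]; simp [quatExpI, quatJ]
  · rw [Quaternion.imJ_mul]; simp [quatExpI, quatJ]
  · rw [Quaternion.imK_mul]; simp [quatExpI, quatJ]

theorem star_quatExpI (a : ℝ) : star (quatExpI a) = quatExpI (-a) := by
  ext
  · rw [Quaternion.re_star]; simp [quatExpI]
  · rw [Quaternion.imI_star]; simp [quatExpI]
  · rw [Quaternion.imJ_star]; simp [quatExpI]
  · rw [Quaternion.imK_star]; simp [quatExpI]

theorem star_quatJ : star quatJ = quatJ * quatExpI Real.pi := by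
  ext
  · rw [Quaternion.re_star, Quaternion.re_mul]; simp [quatExpI, quatJ]
  · rw [Quaternion.imI_star, Quaternion.imI_mul]; simp [quatExpI, quatJ]
  · rw [Quaternion.imJ_star, Quaternion.imJ_mul]; simp [quatExpI, quatJ]
  · rw [Quaternion.imK_star, Quaternion.imK_mul]; simp [quatExpI, quatJ]

/-- The binary dihedral group `S¹_A ∪ S¹_B`, a subgroup of the unit quaternions. -/
noncomputable def binaryDihedral : Subgroup (unitary ℍ[ℝ]) where
  carrier := {q | (q : ℍ[ℝ]) ∈ circleA ∪ circleB}
  one_mem' := Or.inl ⟨0, by ext <;> simp [quatExpI]⟩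
  mul_mem' := by
    rintro ⟨_, _⟩ ⟨_, _⟩ (⟨a, rfl⟩ | ⟨a, rfl⟩) (⟨b, rfl⟩ | ⟨b, rfl⟩)
    · exact Or.inl ⟨a + b, quatExpI_mul a b⟩
    · refine Or.inr ⟨-a + b, ?_⟩
      change quatExpI a * (quatJ * quatExpI b) = _
      rw [← mul_assoc, quatExpI_mul_quatJ, mul_assoc, quatExpI_mul]
    · refine Or.inr ⟨a + b, ?_⟩
      change quatJ * quatExpI a * quatExpI b = _
      rw [mul_assoc, quatExpI_mul]
    · refine Or.inl ⟨Real.pi + (-a + b), ?_⟩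
      change quatJ * quatExpI a * (quatJ * quatExpI b) = _
      rw [mul_assoc, ← mul_assoc (quatExpI a), quatExpI_mul_quatJ, mul_assoc, quatExpI_mul,
        ← mul_assoc, quatJ_mul_quatJ, quatExpI_mul]
  inv_mem' := by
    rintro ⟨_, _⟩ (⟨a, rfl⟩ | ⟨a, rfl⟩)
    · exact Or.inl ⟨-a, star_quatExpI a⟩
    · refine Or.inr ⟨a + Real.pi, ?_⟩
      change star (quatJ * quatExpI a) = _
      rw [star_mul, star_quatExpI, star_quatJ, ← mul_assoc, quatExpI_mul_quatJ, mul_assoc,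
        quatExpI_mul, neg_neg]

namespace MarkedLinkDiagram

variable (D : MarkedLinkDiagram)

/-- The binary dihedral representations of `π₁(S³ ∖ (L ∪ ω))` that take the meridians of `L` into
`S¹_B` and the meridians of `ω` to `-1`. -/
def RepB : Type :=
  {ρ : D.ComplementGroup →* binaryDihedral //
    (∀ d, D.isLink d → ((ρ (D.meridian d) : unitary ℍ[ℝ]) : ℍ[ℝ]) ∈ circleB) ∧
    (∀ d, ¬ D.isLink d → ((ρ (D.meridian d) : unitary ℍ[ℝ]) : ℍ[ℝ]) = -1)}

/-- Conjugacy of representations by the circle `S¹_A`; it adds a common constant to the angles `θ`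
of the images `J e^{Iθ}` of the meridians of `L`. -/
def repBSetoid : Setoid D.RepB where
  r ρ ρ' := ∃ g : binaryDihedral, ((g : unitary ℍ[ℝ]) : ℍ[ℝ]) ∈ circleA ∧
    ∀ x, ρ'.1 x = g * ρ.1 x * g⁻¹
  iseqv := by
    refine ⟨fun ρ => ⟨1, ⟨0, by ext <;> simp [quatExpI]⟩, by simp⟩, ?_, ?_⟩
    · rintro ρ ρ' ⟨g, ⟨a, ha⟩, h⟩
      refine ⟨g⁻¹, ⟨-a, ?_⟩, fun x => by rw [h]; group⟩
      rw [← star_quatExpI, ← ha]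
      rfl
    · rintro ρ ρ' ρ'' ⟨g, ⟨a, ha⟩, h⟩ ⟨g', ⟨a', ha'⟩, h'⟩
      refine ⟨g' * g, ⟨a' + a, ?_⟩, fun x => by rw [h', h]; group⟩
      rw [← quatExpI_mul, ← ha, ← ha']
      rfl

/-- The set `R_B(L, ω)` of conjugacy classes of marked binary dihedral representations. -/
def RB : Type := Quotient D.repBSetoid

end MarkedLinkDiagram

/-! ### Cycles on a planar diagram bound -/

section PermIncidence

variable {X : Type*}

/-! A representation in `RepB` is determined by the angles `θ` in ℝ/2πℤ of the images `J e^{Iθ}` of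
the meridians of `L`. The Wirtinger relations become affine equations for these angles on the erased
diagram (`IsColoring`). Since the meridians of `ω` go to the central element -1, the marking enters
only through the constants: the angle changes by π along an edge, at an overpass, at a subdivision
point and where `L` crosses `ω`, but by 0 at an end point of `ω`. Conjugation by the circle `S¹_A`
adds constants to `θ`. Hence, as soon as one solution exists, subtracting it identifies `RB` with
the homogeneous colorings modulo constants (`nonempty_RB_equiv`). This quotient depends on the
diagram of `L` only, and it is finite when the determinant does not vanish, because a coloring
normalised at one dart is then torsion (`exists_smul_eq_zero_of_isColoring`).

What remains is the existence of a solution (`exists_isColoring`). With one equation for each edge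
and one for each strand at a vertex, the real system is square, and its kernel is at most a line
because the determinant is nonzero. A checkerboard colouring of the regions yields one relation
among the equations, with coefficients 0 and ±1, so the image is exactly the hyperplane defined by
this relation. The constants are integral multiples of π that matter only modulo 2π, so the
obstruction is the parity of a single integer. It is even because `ω` has an even number of end
points (`even_coloringRelation_dotProduct`, `four_dvd_card_isEndpoint`).

Planarity is used for the checkerboard colouring: by Euler's formula the first homology modulo 2 of
the diagram's surface vanishes, so the cycle formed by the edges of `L` bounds a set of faces
(`exists_coboundary_of_euler`). -/

theorem sameCycle_involutive_iff {s : Equiv.Perm X} (hs : ∀ d, s (s d) = d) (a b : X) :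
    s.SameCycle a b ↔ b = a ∨ b = s a := by
  constructor
  · rintro ⟨i, rfl⟩
    have h2 : s ^ (2 : ℤ) = 1 := by
      ext d; simpa [zpow_ofNat, pow_two] using hs d
    rcases Int.even_or_odd' i with ⟨k, rfl | rfl⟩
    · left; simp [zpow_mul, h2]
    · right; simp [zpow_add, zpow_mul, h2]
  · rintro (rfl | rfl)
    · exact Equiv.Perm.SameCycle.refl _ _
    · exact ⟨1, by simp⟩

theorem sameCycle_iff_of_pow_eq {r : Equiv.Perm X} {a : X} {n : ℕ} (hn : 0 < n)
    (h : (r ^ n) a = a) (b : X) : r.SameCycle a b ↔ ∃ i < n, b = (r ^ i) a := by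
  constructor
  · rintro ⟨i, rfl⟩
    have hm : ∀ k : ℤ, ((r ^ n) ^ k) a = a :=
      Equiv.Perm.zpow_apply_eq_self_of_apply_eq_self h
    refine ⟨(i % n).toNat, by have := Int.emod_lt_of_pos i (by omega : (0 : ℤ) < n); omega, ?_⟩
    have h0 := Int.emod_nonneg i (by omega : (n : ℤ) ≠ 0)
    rw [← zpow_natCast, Int.toNat_of_nonneg h0]
    conv_lhs => rw [← Int.emod_add_mul_ediv i n, zpow_add, zpow_mul, zpow_natCast,
      Equiv.Perm.mul_apply, hm]
  · rintro ⟨i, -, rfl⟩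
    exact ⟨i, by simp⟩

variable [Finite X]

open Classical in
/-- The incidence matrix, modulo 2, of the cycles of two permutations. -/
noncomputable def cycleIncidence (r s : Equiv.Perm X) :
    Matrix (Quotient (Equiv.Perm.SameCycle.setoid s)) (Quotient (Equiv.Perm.SameCycle.setoid r))
      (ZMod 2) :=
  letI := Fintype.ofFinite X
  fun e v => ∑ d : X, if (Quotient.mk _ d = e ∧ Quotient.mk _ d = v) then 1 else 0

theorem cycleIncidence_transpose (r s : Equiv.Perm X) :
    (cycleIncidence r s).transpose = cycleIncidence s r := by
  ext v e
  classical
  exact Finset.sum_congr rfl fun d _ => if_congr and_comm rfl rfl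

open Classical in
theorem cycleIncidence_mulVec [Fintype X] (r s : Equiv.Perm X)
    [Fintype (Quotient (Equiv.Perm.SameCycle.setoid r))]
    (g : Quotient (Equiv.Perm.SameCycle.setoid r) → ZMod 2)
    (e : Quotient (Equiv.Perm.SameCycle.setoid s)) :
    (cycleIncidence r s).mulVec g e =
      ∑ d : X, if (Quotient.mk _ d : Quotient (Equiv.Perm.SameCycle.setoid s)) = e
        then g (Quotient.mk _ d) else 0 := by
  simp only [Matrix.mulVec, dotProduct, cycleIncidence, Finset.sum_mul]
  rw [Finset.sum_comm]
  refine Finset.sum_congr (by ext; simp) fun d _ => ?_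
  by_cases h : (Quotient.mk _ d : Quotient (Equiv.Perm.SameCycle.setoid s)) = e <;> simp [h]

/-- This is the coboundary map. Since `s` has no fixed points, every edge has two distinct darts,
and both are counted even if they lie on the same cycle of `r`, where the two terms cancel modulo 2.
-/
theorem cycleIncidence_mulVec_involutive (r : Equiv.Perm X) {s : Equiv.Perm X}
    (hs : ∀ d, s (s d) = d) (hs' : ∀ d, s d ≠ d)
    [Fintype (Quotient (Equiv.Perm.SameCycle.setoid r))]
    (g : Quotient (Equiv.Perm.SameCycle.setoid r) → ZMod 2) (d : X) :
    (cycleIncidence r s).mulVec g (Quotient.mk _ d) =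
      g (Quotient.mk _ d) + g (Quotient.mk _ (s d)) := by
  classical
  let := Fintype.ofFinite X
  rw [cycleIncidence_mulVec, ← Finset.sum_filter]
  have : (Finset.univ.filter fun a : X =>
      (Quotient.mk _ a : Quotient (Equiv.Perm.SameCycle.setoid s)) = Quotient.mk _ d) =
      {d, s d} := by
    ext a
    simp only [Finset.mem_filter, Finset.mem_univ, true_and, Finset.mem_insert,
      Finset.mem_singleton]
    rw [eq_comm, Quotient.eq]
    exact sameCycle_involutive_iff hs d a
  rw [this, Finset.sum_pair (hs' d).symm]

/-- A function on vertices with zero coboundary takes equal values at the ends of each edge, so it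
is a function on the connected components; `F` is the pullback of such functions. -/
theorem finrank_ker_cycleIncidence (r : Equiv.Perm X) {s : Equiv.Perm X}
    (hs : ∀ d, s (s d) = d) (hs' : ∀ d, s d ≠ d)
    [Fintype (Quotient (Equiv.Perm.SameCycle.setoid r))] :
    Module.finrank (ZMod 2) (LinearMap.ker (cycleIncidence r s).mulVecLin) =
      Nat.card (MulAction.orbitRel.Quotient (Subgroup.closure {r, s}) X) := by
  classical
  have hr : r ∈ Subgroup.closure {r, s} := Subgroup.subset_closure (by simp)
  have hsm : s ∈ Subgroup.closure {r, s} := Subgroup.subset_closure (by simp)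
  let := Fintype.ofFinite (MulAction.orbitRel.Quotient (Subgroup.closure {r, s}) X)
  let p : Quotient (Equiv.Perm.SameCycle.setoid r) →
      MulAction.orbitRel.Quotient (Subgroup.closure {r, s}) X :=
    Quotient.map' id (by
      rintro a b ⟨i, rfl⟩
      exact MulAction.orbitRel_apply.mpr
        ⟨⟨(r ^ i)⁻¹, inv_mem (zpow_mem hr i)⟩, by simp [Subgroup.smul_def]⟩)
  have hp : Function.Surjective p := by
    intro q
    induction q using Quotient.inductionOn' with | _ a => exact ⟨Quotient.mk _ a, rfl⟩
  let F := LinearMap.funLeft (ZMod 2) (ZMod 2) p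
  have hF : Function.Injective F := LinearMap.funLeft_injective_of_surjective _ _ _ hp
  have hrange : LinearMap.range F = LinearMap.ker (cycleIncidence r s).mulVecLin := by
    ext g
    rw [LinearMap.mem_ker]
    constructor
    · rintro ⟨f, rfl⟩
      ext e
      induction e using Quotient.inductionOn with | _ d =>
      simp only [Matrix.mulVecLin_apply, cycleIncidence_mulVec_involutive r hs hs']
      have : p (Quotient.mk _ (s d)) = p (Quotient.mk _ d) :=
        Quotient.sound' (MulAction.orbitRel_apply.mpr ⟨⟨s, hsm⟩, rfl⟩)
      simp [F, LinearMap.funLeft_apply, this, CharTwo.add_self_eq_zero]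
    · intro h
      have hg : ∀ d, g (Quotient.mk _ (s d)) = g (Quotient.mk _ d) := fun d => by
        have := congrFun h (Quotient.mk _ d)
        rw [Matrix.mulVecLin_apply, cycleIncidence_mulVec_involutive r hs hs'] at this
        exact (CharTwo.add_eq_zero.mp this).symm
      have hg' : ∀ d, g (Quotient.mk _ (r d)) = g (Quotient.mk _ d) := fun d =>
        congrArg g (Quotient.sound ⟨-1, by simp⟩)
      have hH : ∀ k ∈ Subgroup.closure {r, s}, ∀ d, g (Quotient.mk _ (k d)) =
          g (Quotient.mk _ d) := by
        intro k hk
        induction hk using Subgroup.closure_induction with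
        | mem x hx =>
          rcases hx with rfl | rfl
          · exact hg'
          · exact hg
        | one => simp
        | mul x y _ _ hx hy => intro d; rw [Equiv.Perm.mul_apply, hx, hy]
        | inv x _ hx => intro d; rw [← hx]; simp
      refine ⟨fun q => Quotient.liftOn' q (fun d => g (Quotient.mk _ d)) ?_, ?_⟩
      · intro a b hab
        obtain ⟨⟨k, hk⟩, rfl⟩ := MulAction.orbitRel_apply.mp hab
        exact hH k hk b
      · ext e
        induction e using Quotient.inductionOn with | _ d => rfl
  rw [← hrange, LinearMap.finrank_range_of_inj hF, Module.finrank_fintype_fun_eq_card,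
    Nat.card_eq_fintype_card]

/-- The dual graph, whose vertices are the faces, has the same connected components as the graph
itself. -/
theorem Subgroup.closure_mul_pair {G : Type*} [Group G] (r s : G) :
    Subgroup.closure {r * s, s} = Subgroup.closure {r, s} := by
  apply le_antisymm <;> rw [Subgroup.closure_le] <;> rintro x (rfl | rfl)
  · exact mul_mem (Subgroup.subset_closure (by simp)) (Subgroup.subset_closure (by simp))
  · exact Subgroup.subset_closure (by simp)
  · have := mul_mem (Subgroup.subset_closure (show x * s ∈ ({x * s, s} : Set G) by simp))
      (inv_mem (Subgroup.subset_closure (show s ∈ ({x * s, s} : Set G) by simp)))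
    simpa using this
  · exact Subgroup.subset_closure (by simp)

/-- On a sphere, a cycle modulo 2 of edges is the boundary of a set of faces. -/
theorem exists_coboundary_of_euler (r s : Equiv.Perm X) (hs : ∀ d, s (s d) = d)
    (hs' : ∀ d, s d ≠ d)
    (heuler : Nat.card (Quotient (Equiv.Perm.SameCycle.setoid r)) +
        Nat.card (Quotient (Equiv.Perm.SameCycle.setoid (r * s))) =
      Nat.card (Quotient (Equiv.Perm.SameCycle.setoid s)) +
        2 * Nat.card (MulAction.orbitRel.Quotient (Subgroup.closure {r, s}) X))
    (c : Quotient (Equiv.Perm.SameCycle.setoid s) → ZMod 2)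
    (hc : ∀ [Fintype (Quotient (Equiv.Perm.SameCycle.setoid s))],
      (cycleIncidence s r).mulVec c = 0) :
    ∃ φ : X → ZMod 2, (∀ d, φ (r (s d)) = φ d) ∧
      ∀ d, φ d + φ (s d) = c (Quotient.mk _ d) := by
  classical
  let := Fintype.ofFinite X
  let := Fintype.ofFinite (Quotient (Equiv.Perm.SameCycle.setoid r))
  let := Fintype.ofFinite (Quotient (Equiv.Perm.SameCycle.setoid s))
  let := Fintype.ofFinite (Quotient (Equiv.Perm.SameCycle.setoid (r * s)))
  have h1 := LinearMap.finrank_range_add_finrank_ker (cycleIncidence r s).mulVecLin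
  have h2 := LinearMap.finrank_range_add_finrank_ker (cycleIncidence (r * s) s).mulVecLin
  have h3 := LinearMap.finrank_range_add_finrank_ker (cycleIncidence s r).mulVecLin
  rw [finrank_ker_cycleIncidence r hs hs', Module.finrank_fintype_fun_eq_card] at h1
  rw [finrank_ker_cycleIncidence (r * s) hs hs', Module.finrank_fintype_fun_eq_card,
    Subgroup.closure_mul_pair] at h2
  rw [Module.finrank_fintype_fun_eq_card] at h3
  have hrank : Module.finrank (ZMod 2) (LinearMap.range (cycleIncidence r s).mulVecLin) =
      Module.finrank (ZMod 2) (LinearMap.range (cycleIncidence s r).mulVecLin) := by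
    have := Matrix.rank_transpose (cycleIncidence r s)
    rw [cycleIncidence_transpose] at this
    exact this.symm
  -- The boundary of a set of faces is a cycle: around a vertex, the faces on the two sides of the
  -- darts are the same up to a rotation.
  have hle : LinearMap.range (cycleIncidence (r * s) s).mulVecLin ≤
      LinearMap.ker (cycleIncidence s r).mulVecLin := by
    rintro _ ⟨φ, rfl⟩
    rw [LinearMap.mem_ker]
    ext v
    simp only [Matrix.mulVecLin_apply]
    rw [cycleIncidence_mulVec]
    simp only [cycleIncidence_mulVec_involutive (r * s) hs hs', ← Finset.sum_filter]
    rw [Finset.sum_add_distrib, Pi.zero_apply]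
    have : ∑ d : X with (Quotient.mk _ d : Quotient (Equiv.Perm.SameCycle.setoid r)) = v,
        φ (Quotient.mk _ (s d)) =
        ∑ d : X with (Quotient.mk _ d : Quotient (Equiv.Perm.SameCycle.setoid r)) = v,
        φ (Quotient.mk _ d) := by
      -- The darts `s d` and `r d` lie on the same face, because `(r * s) (s d) = r d`.
      refine Finset.sum_equiv r (fun d => ?_) (fun d _ => ?_)
      · have : (Quotient.mk _ (r d) : Quotient (Equiv.Perm.SameCycle.setoid r)) =
          Quotient.mk _ d := Quotient.sound ⟨-1, by simp⟩
        simp [this]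
      · exact congrArg φ (Quotient.sound ⟨1, by simp [hs]⟩)
    rw [this, CharTwo.add_self_eq_zero]
  -- With `C` components, the cycles have dimension `E - (V - C)` and the boundaries have dimension
  -- `F - C`; Euler's formula makes these equal.
  have heq := Submodule.eq_of_le_of_finrank_le hle (by
    simp only [Nat.card_eq_fintype_card] at heuler h1 h2 h3
    omega)
  have hmem : c ∈ LinearMap.ker (cycleIncidence s r).mulVecLin := hc
  rw [← heq] at hmem
  obtain ⟨φ, rfl⟩ := hmem
  refine ⟨fun d => φ (Quotient.mk _ d), fun d => congrArg φ (Quotient.sound ⟨-1, ?_⟩), fun d => ?_⟩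
  · rw [zpow_neg, zpow_one, Equiv.Perm.inv_eq_iff_eq]; rfl
  · rw [Matrix.mulVecLin_apply, cycleIncidence_mulVec_involutive (r * s) hs hs']

end PermIncidence

/-! ### Checkerboard colourings of planar marked diagrams -/

namespace MarkedLinkDiagram

variable (D : MarkedLinkDiagram)

theorem vertex_eq_iff {a b : D.Dart} : D.vertex a = D.vertex b ↔ D.rot.SameCycle a b :=
  Quotient.eq

open Classical in
theorem sum_vertex_of_isSubdivision [Fintype D.Dart] {A : Type*} [AddCommMonoid A] {d : D.Dart}
    (h : D.IsSubdivision d) (g : D.Dart → A) :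
    ∑ a with D.vertex a = D.vertex d, g a = g d + g (D.rot d) := by
  have : (Finset.univ.filter fun a => D.vertex a = D.vertex d) = {d, D.rot d} := by
    ext a
    rw [Finset.mem_filter, eq_comm (a := D.vertex a), vertex_eq_iff,
      sameCycle_iff_of_pow_eq two_pos (by simpa [pow_two] using h.2)]
    constructor
    · rintro ⟨-, i, hi, rfl⟩
      interval_cases i <;> simp
    · intro ha
      simp only [Finset.mem_insert, Finset.mem_singleton] at ha
      rcases ha with rfl | rfl
      · exact ⟨Finset.mem_univ _, 0, by simp⟩
      · exact ⟨Finset.mem_univ _, 1, by simp⟩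
  rw [this, Finset.sum_pair h.1.symm]

open Classical in
theorem sum_vertex_of_isEndpoint [Fintype D.Dart] {A : Type*} [AddCommMonoid A] {d : D.Dart}
    (h : D.IsEndpoint d) (g : D.Dart → A) :
    ∑ a with D.vertex a = D.vertex d, g a = g d + (g (D.rot d) + g (D.rot (D.rot d))) := by
  have : (Finset.univ.filter fun a => D.vertex a = D.vertex d) =
      {d, D.rot d, D.rot (D.rot d)} := by
    ext a
    rw [Finset.mem_filter, eq_comm (a := D.vertex a), vertex_eq_iff,
      sameCycle_iff_of_pow_eq three_pos h.2]
    constructor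
    · rintro ⟨-, i, hi, rfl⟩
      interval_cases i <;> simp [pow_succ]
    · intro ha
      simp only [Finset.mem_insert, Finset.mem_singleton] at ha
      rcases ha with rfl | rfl | rfl
      · exact ⟨Finset.mem_univ _, 0, by simp⟩
      · exact ⟨Finset.mem_univ _, 1, by simp⟩
      · exact ⟨Finset.mem_univ _, 2, by simp [pow_succ]⟩
  have h1 := h.1
  have h2 : d ≠ D.rot (D.rot d) := fun h2 => h1 (by
    have h3 := h.2
    rw [← h2] at h3
    exact h3)
  rw [this, Finset.sum_insert, Finset.sum_pair]
  · exact fun h' => h1 (D.rot.injective h').symm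
  · simp [h1.symm, h2]

open Classical in
theorem sum_vertex_of_isCrossing [Fintype D.Dart] {A : Type*} [AddCommMonoid A] {d : D.Dart}
    (h : D.IsCrossing d) (g : D.Dart → A) :
    ∑ a with D.vertex a = D.vertex d, g a =
      g d + (g (D.rot d) + (g (D.rot (D.rot d)) + g (D.rot (D.rot (D.rot d))))) := by
  have : (Finset.univ.filter fun a => D.vertex a = D.vertex d) =
      {d, D.rot d, D.rot (D.rot d), D.rot (D.rot (D.rot d))} := by
    ext a
    rw [Finset.mem_filter, eq_comm (a := D.vertex a), vertex_eq_iff,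
      sameCycle_iff_of_pow_eq four_pos h.2]
    constructor
    · rintro ⟨-, i, hi, rfl⟩
      interval_cases i <;> simp [pow_succ]
    · intro ha
      simp only [Finset.mem_insert, Finset.mem_singleton] at ha
      rcases ha with rfl | rfl | rfl | rfl
      · exact ⟨Finset.mem_univ _, 0, by simp⟩
      · exact ⟨Finset.mem_univ _, 1, by simp⟩
      · exact ⟨Finset.mem_univ _, 2, by simp [pow_succ]⟩
      · exact ⟨Finset.mem_univ _, 3, by simp [pow_succ]⟩
  obtain ⟨h2, h4⟩ := h
  have h1 : d ≠ D.rot d := fun h1 => h2 (by rw [← h1, ← h1])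
  have h3 : d ≠ D.rot (D.rot (D.rot d)) := fun h3 => h1 (by rw [← h3] at h4; exact h4.symm)
  rw [this, Finset.sum_insert, Finset.sum_insert, Finset.sum_pair]
  · exact fun h' => h1 (D.rot.injective (D.rot.injective h'))
  · simp [h1, Ne.symm h2]
  · simp [h1, h2.symm, h3]

open Classical in
/-- The regions of a planar diagram can be coloured with two colours which alternate at the
edges of `L`, but not at those of `ω`. -/
theorem exists_checkerboard (h : D.IsPlanar) : ∃ φ : D.Dart → ZMod 2, ∀ d,
    φ (D.edge d) = φ d + (if D.isLink d then 1 else 0) ∧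
    φ (D.rot d) = φ d + (if D.isLink d then 1 else 0) := by
  let : Fintype D.Dart := Fintype.ofFinite _
  let l : D.Dart → ZMod 2 := fun d => if D.isLink d then 1 else 0
  have hl : ∀ d, l (D.edge d) = l d := fun d => by simp only [l, D.isLink_edge]
  let c : D.Edge → ZMod 2 := fun e => Quotient.liftOn e l (by
    intro a b hab
    rcases (sameCycle_involutive_iff D.edge_edge a b).mp hab with rfl | rfl
    · rfl
    · exact (hl a).symm)
  -- The edges of `L` form a cycle modulo 2: every vertex has an even number of darts in `L`, also
  -- an end point of `ω`, where there are two.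
  obtain ⟨φ, hφ, hφ'⟩ := exists_coboundary_of_euler D.rot D.edge D.edge_edge D.edge_ne h c (by
    intro _
    ext v
    induction v using Quotient.inductionOn with | _ d =>
    rw [cycleIncidence_mulVec, ← Finset.sum_filter]
    change ∑ a with D.vertex a = D.vertex d, l a = 0
    rcases D.vertex_cases d with ⟨h1, h2, h3⟩ | ⟨h1, h2, h3⟩ | ⟨h1, h2, h3, h4⟩
    · rw [D.sum_vertex_of_isSubdivision ⟨h1, h2⟩]
      simp [l, h3, CharTwo.add_self_eq_zero]
    · rw [D.sum_vertex_of_isEndpoint ⟨h1, h2⟩]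
      rcases h3 with ⟨a, b, c⟩ | ⟨a, b, c⟩ | ⟨a, b, c⟩ <;>
        simp [l, a, b, c, CharTwo.add_self_eq_zero]
    · rw [D.sum_vertex_of_isCrossing ⟨h1, h2⟩]
      have h5 : D.isLink (D.rot (D.rot (D.rot d))) ↔ D.isLink (D.rot d) := by
        by_cases hr : D.isLink (D.rot d)
        · simp [hr, D.isLink_rot_three ⟨h1, h2⟩ hr]
        · have h1' : D.rot (D.rot (D.rot (D.rot d))) ≠ D.rot (D.rot d) := by
            rw [h2]; exact h1.symm
          have := D.isLink_rot_three (d := D.rot (D.rot d))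
            ⟨by rw [h2]; exact h1.symm, by rw [h2]⟩
          rw [h2] at this
          tauto
      simp only [l, h3, h5]
      generalize (if D.isLink d then (1 : ZMod 2) else 0) = x
      generalize (if D.isLink (D.rot d) then (1 : ZMod 2) else 0) = y
      revert x y
      decide)
  have he : ∀ d, φ (D.edge d) = φ d + l d := fun d => by
    have := hφ' d
    change _ = l d at this
    rw [← this, ← add_assoc, CharTwo.add_self_eq_zero, zero_add]
  refine ⟨φ, fun d => ⟨he d, ?_⟩⟩
  have := hφ (D.edge d)
  rw [D.edge_edge] at this
  rw [this]
  exact he d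

theorem coe_edge_erase (d : D.erase.Dart) : ((D.erase.edge d).1 : D.Dart) = D.edge d.1 := rfl

/-- The colours alternate around the vertices of the diagram of a link. -/
theorem exists_alternating_erase (h : D.IsPlanar) : ∃ σ : D.erase.Dart → ℤˣ,
    ∀ d, σ (D.erase.edge d) = -σ d ∧ σ (D.erase.rot d) = -σ d := by
  obtain ⟨φ, hφ⟩ := D.exists_checkerboard h
  let s : ZMod 2 → ℤˣ := fun x => if x = 0 then 1 else -1
  have hs : ∀ x, s (x + 1) = - s x := by
    intro x
    fin_cases x <;> decide
  refine ⟨fun d => s (φ d.1), fun d => ⟨?_, ?_⟩⟩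
  · change s (φ (D.edge d.1)) = _
    rw [(hφ d.1).1, if_pos d.2, hs]
  · change s (φ (D.linkRot d).1) = _
    by_cases hr : D.isLink (D.rot d.1)
    · rw [D.linkRot_of_isLink d hr, (hφ d.1).2, if_pos d.2, hs]
    -- The colour does not change across the skipped dart of `ω`, so only one sign change occurs.
    · rw [D.linkRot_of_not_isLink d hr, (hφ _).2, if_neg hr, add_zero, (hφ d.1).2, if_pos d.2, hs]

end MarkedLinkDiagram

/-! ### Colorings and the coloring matrix -/

namespace MarkedLinkDiagram

variable (D : MarkedLinkDiagram)

variable {D} in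
theorem IsCrossing.rot {d : D.Dart} (h : D.IsCrossing d) : D.IsCrossing (D.rot d) :=
  ⟨fun h' => h.1 (D.rot.injective h'), congrArg D.rot h.2⟩

variable {D} in
theorem IsSubdivision.rot {d : D.Dart} (h : D.IsSubdivision d) : D.IsSubdivision (D.rot d) :=
  ⟨fun h' => h.1 (D.rot.injective h'), congrArg D.rot h.2⟩

variable {D} in
theorem IsEndpoint.rot {d : D.Dart} (h : D.IsEndpoint d) : D.IsEndpoint (D.rot d) :=
  ⟨fun h' => h.1 (D.rot.injective h'), congrArg D.rot h.2⟩

variable {D} in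
theorem IsSubdivision.not_isCrossing {d : D.Dart} (h : D.IsSubdivision d) : ¬ D.IsCrossing d :=
  fun h' => h'.1 h.2

variable {D} in
theorem IsCrossing.not_isSubdivision {d : D.Dart} (h : D.IsCrossing d) : ¬ D.IsSubdivision d :=
  fun h' => h'.not_isCrossing h

variable {D} in
theorem IsEndpoint.not_isSubdivision {d : D.Dart} (h : D.IsEndpoint d) : ¬ D.IsSubdivision d :=
  fun h' => h.1 (by rw [← h'.2, h.2, h'.2])

variable {D} in
theorem IsEndpoint.not_isCrossing {d : D.Dart} (h : D.IsEndpoint d) : ¬ D.IsCrossing d :=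
  fun h' => h.1 (by
    have := h'.2
    rw [h.2] at this
    exact this)

variable {D} in
theorem IsCrossing.isOver_rot {d : D.Dart} (h : D.IsCrossing d) :
    D.isOver (D.rot d) ↔ ¬ D.isOver d := by
  rcases D.vertex_cases d with ⟨h1, h2, -⟩ | ⟨h1, h2, -⟩ | ⟨-, -, -, h'⟩
  · exact absurd h (IsSubdivision.not_isCrossing ⟨h1, h2⟩)
  · exact absurd h (IsEndpoint.not_isCrossing ⟨h1, h2⟩)
  · exact h'

variable {D} in
theorem IsCrossing.isOver_rot_rot {d : D.Dart} (h : D.IsCrossing d) :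
    D.isOver (D.rot (D.rot d)) ↔ D.isOver d := by
  rw [h.rot.isOver_rot, h.isOver_rot, not_not]

/-- Solutions of the equations for the angles of a binary dihedral representation: the angle
changes by `c` along an edge and at an overpass, by `e` at a subdivision point, and the alternating
sum of the four angles at a crossing vanishes. -/
structure IsColoring {T : Type*} [AddCommGroup T] (c : T) (e : D.Dart → T) (θ : D.Dart → T) :
    Prop where
  edge : ∀ d, θ (D.edge d) = θ d + c
  subdivision : ∀ d, D.IsSubdivision d → θ (D.rot d) = θ d + e d
  overpass : ∀ d, D.IsCrossing d → D.isOver d → θ (D.rot (D.rot d)) = θ d + c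
  crossing : ∀ d, D.IsCrossing d →
    θ d - θ (D.rot d) + θ (D.rot (D.rot d)) - θ (D.rot (D.rot (D.rot d))) = 0

variable {D} in
/-- A homogeneous coloring is constant on arcs. -/
theorem IsColoring.exists_arc {T : Type*} [AddCommGroup T] {θ : D.Dart → T}
    (h : D.IsColoring 0 0 θ) : ∃ x : D.Arc → T, ∀ d, x (D.arc d) = θ d := by
  have hstep : ∀ a b, D.ArcStep a b → θ a = θ b := by
    intro a b hab
    rcases hab with _ | hs | ⟨hc, ho⟩
    · simp [h.edge]
    · simp [h.subdivision _ hs]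
    · simp [h.overpass _ hc ho]
  refine ⟨fun q => Quotient.liftOn q θ ?_, fun d => rfl⟩
  intro a b hab
  induction hab with
  | rel a b hab => exact hstep a b hab
  | refl => rfl
  | symm _ _ _ ih => exact ih.symm
  | trans _ _ _ _ _ ih ih' => exact ih.trans ih'

open Classical in
theorem coloringMatrix_eq_sum [Fintype D.Dart] (c : D.Crossing) (a : D.Arc) :
    D.coloringMatrix c a = ∑ d with D.vertex d = c,
      if D.arc d = a then (if D.isOver d then -1 else 1) else 0 := by
  unfold coloringMatrix
  rw [Nat.card_eq_fintype_card, Nat.card_eq_fintype_card, Fintype.card_subtype,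
    Fintype.card_subtype, Finset.card_filter, Finset.card_filter, Finset.sum_filter]
  push_cast
  rw [← Finset.sum_sub_distrib]
  refine Finset.sum_congr rfl fun d _ => ?_
  by_cases h1 : D.vertex d = c <;> by_cases h2 : D.arc d = a <;> by_cases h3 : D.isOver d <;>
    simp [h1, h2, h3]

-- Summing over darts instead of arcs takes care of arcs that coincide at the crossing.
open Classical in
theorem sum_coloringMatrix_smul [Fintype D.Dart] [Fintype D.Arc] {T : Type*} [AddCommGroup T]
    (c : D.Crossing) (x : D.Arc → T) :
    ∑ a, D.coloringMatrix c a • x a =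
      ∑ d with D.vertex d = c, if D.isOver d then - x (D.arc d) else x (D.arc d) := by
  simp only [coloringMatrix_eq_sum, Finset.sum_smul]
  rw [Finset.sum_comm]
  refine Finset.sum_congr rfl fun d _ => ?_
  rw [Finset.sum_eq_single (D.arc d)]
  · by_cases h : D.isOver d <;> simp [h]
  · intro a _ ha
    simp [ha.symm]
  · simp

open Classical in
/-- A homogeneous coloring is a coloring of the arcs in the kernel of the coloring matrix. -/
theorem IsColoring.sum_coloringMatrix {D : MarkedLinkDiagram} [Fintype D.Dart] [Fintype D.Arc]
    {T : Type*} [AddCommGroup T] {θ : D.Dart → T} (h : D.IsColoring 0 0 θ) {x : D.Arc → T}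
    (hx : ∀ d, x (D.arc d) = θ d) (c : D.Crossing) :
    ∑ a, D.coloringMatrix c a • x a = 0 := by
  rw [sum_coloringMatrix_smul]
  obtain ⟨_, d, hd, rfl⟩ := c
  rw [D.sum_vertex_of_isCrossing hd]
  have := h.crossing d hd
  simp only [hd.rot.rot.isOver_rot, hd.rot.isOver_rot, hd.isOver_rot, hx, not_not]
  -- Upper and lower darts alternate around the crossing, so the row is the alternating sum of the
  -- colours up to a sign that depends on the starting dart.
  by_cases ho : D.isOver d
  · simp only [ho, if_true, not_true_eq_false, if_false]
    rw [← neg_eq_zero, ← this]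
    abel
  · simp only [ho, if_true, not_false_eq_true, if_false]
    rw [← this]
    abel

theorem exists_minor_ne_zero (h : D.determinant ≠ 0) :
    ∃ (p : Fin (Nat.card D.Arc - 1) → D.Crossing) (q : Fin (Nat.card D.Arc - 1) → D.Arc),
      (D.coloringMatrix.submatrix p q).det ≠ 0 := by
  by_contra! hn
  apply h
  unfold determinant
  rw [Finset.gcd_eq_zero_iff]
  rintro ⟨p, q⟩ -
  simp [hn p q]

/-- If the determinant does not vanish, a homogeneous coloring is determined up to torsion by the
colour of a single dart. -/
theorem exists_smul_eq_zero_of_isColoring [Nonempty D.Dart] (hdet : D.determinant ≠ 0) :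
    ∃ (d₀ : D.Dart) (t : ℤ), t ≠ 0 ∧ ∀ (T : Type) [AddCommGroup T] (θ : D.Dart → T),
      D.IsColoring 0 0 θ → θ d₀ = 0 → ∀ d, t • θ d = 0 := by
  classical
  let : Fintype D.Dart := Fintype.ofFinite _
  let : Fintype D.Arc := Fintype.ofFinite _
  obtain ⟨p, q, hpq⟩ := D.exists_minor_ne_zero hdet
  have hq : Function.Injective q := by
    intro i j hij
    by_contra hne
    refine hpq (Matrix.det_zero_of_column_eq hne fun k => ?_)
    simp [hij]
  have hpos : 0 < Fintype.card D.Arc :=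
    Fintype.card_pos_iff.mpr ((inferInstance : Nonempty D.Dart).map D.arc)
  -- The columns of a nonzero minor are distinct, so they omit exactly one arc `a₀`; its colour is
  -- the one to be normalised.
  have hcard : (Finset.univ.image q).card + 1 = Fintype.card D.Arc := by
    rw [Finset.card_image_of_injective _ hq, Finset.card_univ, Fintype.card_fin,
      Nat.card_eq_fintype_card]
    omega
  have hcard' : (Finset.univ.image q)ᶜ.card = 1 := by
    rw [Finset.card_compl]; omega
  obtain ⟨a₀, ha₀⟩ := Finset.card_eq_one.mp hcard'
  have hmem : ∀ a, a ≠ a₀ → ∃ i, q i = a := by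
    intro a ha
    have : a ∉ (Finset.univ.image q)ᶜ := by rw [ha₀]; simpa using ha
    simpa using this
  obtain ⟨d₀, rfl⟩ : ∃ d₀, D.arc d₀ = a₀ := Quotient.exists_rep a₀
  -- The integer `t` is the minor itself: with the colour of `a₀` equal to 0, the other colours are
  -- in the kernel of the submatrix, and multiplication by the adjugate shows that its determinant
  -- kills them in any abelian group.
  refine ⟨d₀, _, hpq, fun T _ θ hθ h0 d => ?_⟩
  obtain ⟨x, hx⟩ := hθ.exists_arc
  rw [← hx] at h0 ⊢
  by_cases hd : D.arc d = D.arc d₀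
  · rw [hd, h0, smul_zero]
  obtain ⟨l, hl⟩ := hmem _ hd
  set N := D.coloringMatrix.submatrix p q with hN
  have hrow : ∀ i, ∑ j, N i j • x (q j) = 0 := by
    intro i
    rw [← hθ.sum_coloringMatrix hx (p i), ← Finset.sum_subset (Finset.subset_univ
      (Finset.univ.image q)) , Finset.sum_image (fun _ _ _ _ h => hq h)]
    · rfl
    · intro a _ ha
      have : a ∈ (Finset.univ.image q)ᶜ := by simpa using ha
      rw [ha₀, Finset.mem_singleton] at this
      rw [this, h0, smul_zero]
  rw [← hl]
  calc N.det • x (q l) = ∑ j, (N.adjugate * N) l j • x (q j) := by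
        rw [Matrix.adjugate_mul, Finset.sum_eq_single l]
        · simp
        · intro j _ hj
          simp [hj.symm]
        · simp
    _ = ∑ i, N.adjugate l i • ∑ j, N i j • x (q j) := by
        simp only [Matrix.mul_apply, Finset.sum_smul, Finset.smul_sum, mul_smul]
        rw [Finset.sum_comm]
    _ = 0 := by simp [hrow]

end MarkedLinkDiagram

/-! ### Counting by pairs, and square systems with one relation -/

theorem sum_subtype_lt_involutive {X A : Type*} [Fintype X] [AddCommMonoid A] {τ : X → X}
    (hτ : ∀ d, τ (τ d) = d) (hτ' : ∀ d, τ d ≠ d) {f : X → ℕ} (hf : Function.Injective f)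
    (g : X → A) :
    ∑ d : {d // f d < f (τ d)}, (g d + g (τ d)) = ∑ d, g d := by
  classical
  rw [← Finset.sum_subtype (Finset.univ.filter fun d => f d < f (τ d)) (by simp)
    (fun d => g d + g (τ d)), Finset.sum_add_distrib,
    ← Finset.sum_filter_add_sum_filter_not Finset.univ (fun d => f d < f (τ d)) g]
  congr 1
  -- The labelling `f` selects one element of each pair `{d, τ d}`; `τ` exchanges the selected and
  -- the other elements, and there are no ties since `τ` has no fixed points.
  refine Finset.sum_bij' (fun d _ => τ d) (fun d _ => τ d) ?_ ?_ ?_ ?_ ?_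
  · intro d hd
    simp only [Finset.mem_filter, Finset.mem_univ, true_and, hτ, not_lt] at hd ⊢
    exact hd.le
  · intro d hd
    simp only [Finset.mem_filter, Finset.mem_univ, true_and, hτ, not_lt] at hd ⊢
    exact lt_of_le_of_ne hd fun h => hτ' d (hf h)
  · intro d _; exact hτ d
  · intro d _; exact hτ d
  · intro d _; rfl

/-- Applied to `edge` and to `turn`, this makes the number of equations equal to the number of
darts. -/
theorem card_subtype_lt_involutive {X : Type*} [Fintype X] {τ : X → X}
    (hτ : ∀ d, τ (τ d) = d) (hτ' : ∀ d, τ d ≠ d) {f : X → ℕ} (hf : Function.Injective f) :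
    2 * Fintype.card {d // f d < f (τ d)} = Fintype.card X := by
  have := sum_subtype_lt_involutive hτ hτ' hf (fun _ => 1)
  simp only [Finset.sum_const, Finset.card_univ, smul_eq_mul, mul_one] at this
  omega

/-- A square linear system whose kernel is at most a line is solvable as soon as the right hand side
satisfies one nontrivial relation that holds among the equations. -/
theorem exists_solution_of_relation {X R : Type*} [Fintype X] [Fintype R]
    (Φ : (X → ℝ) →ₗ[ℝ] (R → ℝ)) (hcard : Fintype.card R = Fintype.card X)
    (hker : Module.finrank ℝ (LinearMap.ker Φ) ≤ 1) {k : R → ℝ} (hk0 : k ≠ 0)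
    (hk : ∀ θ, k ⬝ᵥ Φ θ = 0) {β : R → ℝ} (hβ : k ⬝ᵥ β = 0) : ∃ θ, Φ θ = β := by
  classical
  let ψ : (R → ℝ) →ₗ[ℝ] ℝ := dotProductBilin ℝ ℝ k
  have hψ : ∀ v, ψ v = k ⬝ᵥ v := fun v => rfl
  have hle : LinearMap.range Φ ≤ LinearMap.ker ψ := by
    rintro _ ⟨θ, rfl⟩
    exact hk θ
  have hψ0 : LinearMap.range ψ ≠ ⊥ := by
    intro h
    rw [LinearMap.range_eq_bot] at h
    apply hk0
    have : ψ k = 0 := by rw [h]; rfl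
    rwa [hψ, dotProduct_self_eq_zero] at this
  have h1 := LinearMap.finrank_range_add_finrank_ker Φ
  have h2 := LinearMap.finrank_range_add_finrank_ker ψ
  have h3 : 0 < Module.finrank ℝ (LinearMap.range ψ) :=
    Nat.pos_of_ne_zero fun h => hψ0 (Submodule.finrank_eq_zero.mp h)
  rw [Module.finrank_fintype_fun_eq_card] at h1 h2
  -- The range has codimension at most 1 by the bound on the kernel, and it is contained in the
  -- hyperplane orthogonal to `k`.
  have := Submodule.eq_of_le_of_finrank_le hle (by omega)
  have hmem : β ∈ LinearMap.ker ψ := hβ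
  rwa [← this] at hmem

/-! ### The linear system of the angles and its solvability -/

namespace MarkedLinkDiagram

variable (D : MarkedLinkDiagram)

theorem isSubdivision_or_isCrossing (hD : ∀ d, D.isLink d) (d : D.Dart) :
    D.IsSubdivision d ∨ D.IsCrossing d := by
  rcases D.vertex_cases d with ⟨h1, h2, -⟩ | ⟨-, -, h⟩ | ⟨h1, h2, -⟩
  · exact Or.inl ⟨h1, h2⟩
  · have := hD d
    have := hD (D.rot d)
    have := hD (D.rot (D.rot d))
    tauto
  · exact Or.inr ⟨h1, h2⟩

open Classical in
/-- The other end of the strand through a vertex of two or four darts. -/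
noncomputable def turn (d : D.Dart) : D.Dart :=
  if D.IsCrossing d then D.rot (D.rot d) else D.rot d

variable {D} in
theorem IsCrossing.turn_eq {d : D.Dart} (h : D.IsCrossing d) : D.turn d = D.rot (D.rot d) :=
  if_pos h

variable {D} in
theorem IsSubdivision.turn_eq {d : D.Dart} (h : D.IsSubdivision d) : D.turn d = D.rot d :=
  if_neg h.not_isCrossing

theorem turn_turn (hD : ∀ d, D.isLink d) (d : D.Dart) : D.turn (D.turn d) = d := by
  rcases D.isSubdivision_or_isCrossing hD d with h | h
  · rw [h.turn_eq, h.rot.turn_eq, h.2]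
  · rw [h.turn_eq, h.rot.rot.turn_eq, h.2]

theorem turn_ne (hD : ∀ d, D.isLink d) (d : D.Dart) : D.turn d ≠ d := by
  rcases D.isSubdivision_or_isCrossing hD d with h | h
  · rw [h.turn_eq]; exact h.1
  · rw [h.turn_eq]; exact h.1

open Classical in
/-- The left hand sides of the equations of a coloring at the vertices. -/
noncomputable def vertexForm {T : Type*} [AddCommGroup T] (θ : D.Dart → T) (d : D.Dart) : T :=
  if D.IsCrossing d ∧ ¬ D.isOver d then
    θ d - θ (D.rot d) + θ (D.rot (D.rot d)) - θ (D.rot (D.rot (D.rot d)))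
  else θ d - θ (D.turn d)

open Classical in
/-- The right hand sides of the equations of a coloring at the vertices. -/
noncomputable def vertexConst {T : Type*} [AddCommGroup T] (c : T) (e : D.Dart → T)
    (d : D.Dart) : T :=
  if D.IsCrossing d then (if D.isOver d then c else 0) else e d

section VertexForm

variable {D} {T : Type*} [AddCommGroup T] {θ : D.Dart → T} {c : T} {e : D.Dart → T} {d : D.Dart}

theorem IsSubdivision.vertexForm_eq (h : D.IsSubdivision d) :
    D.vertexForm θ d = θ d - θ (D.rot d) := by
  rw [vertexForm, if_neg fun h' => h.not_isCrossing h'.1, h.turn_eq]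

theorem IsCrossing.vertexForm_of_isOver (h : D.IsCrossing d) (ho : D.isOver d) :
    D.vertexForm θ d = θ d - θ (D.rot (D.rot d)) := by
  rw [vertexForm, if_neg fun h' => h'.2 ho, h.turn_eq]

theorem IsCrossing.vertexForm_of_not_isOver (h : D.IsCrossing d) (ho : ¬ D.isOver d) :
    D.vertexForm θ d = θ d - θ (D.rot d) + θ (D.rot (D.rot d)) - θ (D.rot (D.rot (D.rot d))) :=
  if_pos ⟨h, ho⟩

theorem IsSubdivision.vertexConst_eq (h : D.IsSubdivision d) : D.vertexConst c e d = e d :=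
  if_neg h.not_isCrossing

theorem IsCrossing.vertexConst_of_isOver (h : D.IsCrossing d) (ho : D.isOver d) :
    D.vertexConst c e d = c := by
  rw [vertexConst, if_pos h, if_pos ho]

theorem IsCrossing.vertexConst_of_not_isOver (h : D.IsCrossing d) (ho : ¬ D.isOver d) :
    D.vertexConst c e d = 0 := by
  rw [vertexConst, if_pos h, if_neg ho]

end VertexForm

/-- It suffices to verify one of the two equations for each edge and for each strand at a vertex. -/
theorem isColoring_of_vertexForm (hD : ∀ d, D.isLink d) {f : D.Dart → ℕ}
    (hf : Function.Injective f) {T : Type*} [AddCommGroup T] {c : T} {e θ : D.Dart → T}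
    (hc : c + c = 0) (he : ∀ d, e d + e d = 0)
    (he' : ∀ d, D.IsSubdivision d → e (D.rot d) = e d)
    (h1 : ∀ d, f d < f (D.edge d) → θ d - θ (D.edge d) = c)
    (h2 : ∀ d, f d < f (D.turn d) → D.vertexForm θ d = D.vertexConst c e d) :
    D.IsColoring c e θ := by
  -- Interchanging the two darts of an edge, of a subdivision point or of an upper strand changes
  -- the sign of the left hand side, which is harmless since the constants have order at most two.
  have hc' : -c = c := by rw [neg_eq_iff_add_eq_zero, hc]
  have h1' : ∀ d, θ d - θ (D.edge d) = c := by
    intro d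
    rcases lt_trichotomy (f d) (f (D.edge d)) with h | h | h
    · exact h1 d h
    · exact absurd (hf h).symm (D.edge_ne d)
    · have := h1 (D.edge d) (by rwa [D.edge_edge])
      rw [D.edge_edge] at this
      rw [← neg_sub, this, hc']
  have h2' : ∀ d, D.vertexForm θ d = D.vertexConst c e d := by
    intro d
    rcases lt_trichotomy (f d) (f (D.turn d)) with h | h | h
    · exact h2 d h
    · exact absurd (hf h).symm (D.turn_ne hD d)
    · have := h2 (D.turn d) (by rwa [D.turn_turn hD])
      rcases D.isSubdivision_or_isCrossing hD d with hd | hd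
      · have he'' : -e d = e d := by rw [neg_eq_iff_add_eq_zero, he]
        rw [hd.turn_eq, hd.rot.vertexForm_eq, hd.rot.vertexConst_eq, hd.2, he' d hd] at this
        rw [hd.vertexForm_eq, hd.vertexConst_eq, ← neg_sub, this, he'']
      · rw [hd.turn_eq] at this
        by_cases ho : D.isOver d
        · have ho' := hd.isOver_rot_rot.mpr ho
          rw [hd.rot.rot.vertexForm_of_isOver ho', hd.rot.rot.vertexConst_of_isOver ho',
            hd.2] at this
          rw [hd.vertexForm_of_isOver ho, hd.vertexConst_of_isOver ho, ← neg_sub, this, hc']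
        · have ho' := mt hd.isOver_rot_rot.mp ho
          rw [hd.rot.rot.vertexForm_of_not_isOver ho', hd.rot.rot.vertexConst_of_not_isOver ho',
            hd.2] at this
          rw [hd.vertexForm_of_not_isOver ho, hd.vertexConst_of_not_isOver ho, ← this]
          abel
  refine ⟨fun d => ?_, fun d hd => ?_, fun d hd ho => ?_, fun d hd => ?_⟩
  · rw [← hc', ← h1' d]; abel
  · have := h2' d
    rw [hd.vertexForm_eq, hd.vertexConst_eq] at this
    rw [← sub_eq_iff_eq_add', ← neg_sub, this, neg_eq_iff_add_eq_zero, he]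
  · have := h2' d
    rw [hd.vertexForm_of_isOver ho, hd.vertexConst_of_isOver ho] at this
    rw [← hc', ← this]; abel
  -- The four-term equation is imposed at the lower darts only; at an upper dart it is the negative
  -- of the one at the next dart.
  · by_cases ho : D.isOver d
    · have ho' : ¬ D.isOver (D.rot d) := fun h => hd.isOver_rot.mp h ho
      have := h2' (D.rot d)
      rw [hd.rot.vertexForm_of_not_isOver ho', hd.rot.vertexConst_of_not_isOver ho', hd.2] at this
      rw [← neg_eq_zero, ← this]; abel
    · rw [← hd.vertexForm_of_not_isOver ho, h2' d, hd.vertexConst_of_not_isOver ho]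

/-- The linear system for real colorings, with one equation for each edge and one for each strand
at a vertex. -/
noncomputable def coloringSystem (f : D.Dart → ℕ) : (D.Dart → ℝ) →ₗ[ℝ]
    ({d // f d < f (D.edge d)} ⊕ {d // f d < f (D.turn d)} → ℝ) where
  toFun θ := Sum.elim (fun d => θ d - θ (D.edge d)) (fun d => D.vertexForm θ d)
  map_add' θ θ' := by
    ext (d | d)
    · simp only [Sum.elim_inl, Pi.add_apply]; ring
    · simp only [Sum.elim_inr, Pi.add_apply, vertexForm]
      split_ifs <;> ring
  map_smul' a θ := by
    ext (d | d)
    · simp only [Sum.elim_inl, Pi.smul_apply, smul_eq_mul, RingHom.id_apply]; ring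
    · simp only [Sum.elim_inr, Pi.smul_apply, vertexForm, smul_eq_mul, RingHom.id_apply]
      split_ifs <;> ring

/-- Evaluation at the dart `d₀` is injective on the kernel, since ℝ has no torsion. -/
theorem finrank_ker_coloringSystem_le (hD : ∀ d, D.isLink d) [Nonempty D.Dart]
    (hdet : D.determinant ≠ 0) {f : D.Dart → ℕ} (hf : Function.Injective f) :
    Module.finrank ℝ (LinearMap.ker (D.coloringSystem f)) ≤ 1 := by
  obtain ⟨d₀, t, ht, h⟩ := D.exists_smul_eq_zero_of_isColoring hdet
  let ev : LinearMap.ker (D.coloringSystem f) →ₗ[ℝ] ℝ :=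
    (LinearMap.proj d₀).comp (LinearMap.ker (D.coloringSystem f)).subtype
  have hev : Function.Injective ev := by
    rw [← LinearMap.ker_eq_bot, LinearMap.ker_eq_bot']
    rintro ⟨θ, hθ⟩ h0
    have hcol : D.IsColoring 0 0 θ := by
      rw [LinearMap.mem_ker] at hθ
      refine D.isColoring_of_vertexForm hD hf (by simp) (by simp) (by simp)
        (fun d hd => congrFun hθ (Sum.inl ⟨d, hd⟩)) (fun d hd => ?_)
      have := congrFun hθ (Sum.inr ⟨d, hd⟩)
      simp only [vertexConst, Pi.zero_apply, ite_self]
      exact this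
    ext d
    have := h ℝ θ hcol h0 d
    simpa [ht] using this
  simpa using LinearMap.finrank_le_finrank_of_injective hev

open Classical in
/-- The coefficients of the relation among the equations of a coloring. -/
noncomputable def coloringRelation (σ : D.Dart → ℤˣ) (f : D.Dart → ℕ) :
    {d // f d < f (D.edge d)} ⊕ {d // f d < f (D.turn d)} → ℤ :=
  Sum.elim (fun d => σ d) (fun d => if D.IsCrossing d ∧ D.isOver d then 0 else -σ d)

-- As `σ` changes sign along edges and around vertices, both the edge equations and the vertex
-- equations, weighted by `σ`, add up to the sum of `σ d * θ d` over all darts. The equations of the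
-- upper strands are not needed, because the four-term equation already involves all darts of its
-- crossing.
open Classical in
theorem coloringRelation_dotProduct [Fintype D.Dart] (hD : ∀ d, D.isLink d) {σ : D.Dart → ℤˣ}
    (hσ : ∀ d, σ (D.edge d) = -σ d ∧ σ (D.rot d) = -σ d) {f : D.Dart → ℕ}
    (hf : Function.Injective f) (θ : D.Dart → ℝ) :
    (fun r => (D.coloringRelation σ f r : ℝ)) ⬝ᵥ D.coloringSystem f θ = 0 := by
  let g : D.Dart → ℝ := fun d => ((σ d : ℤ) : ℝ) * θ d
  -- The function `h` moves the term of each upper dart to the lower dart that precedes it. The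
  -- total is unchanged, and the sum of `h` over a strand becomes 0 for an upper strand and the sum
  -- of all four terms for a lower one.
  let u : D.Dart → ℝ := fun d => if D.IsCrossing d ∧ D.isOver d then g d else 0
  let h : D.Dart → ℝ := fun d => g d + (u (D.rot d) - u d)
  have hh : ∑ d, h d = ∑ d, g d := by
    simp only [h, Finset.sum_add_distrib, Finset.sum_sub_distrib]
    rw [Equiv.sum_comp D.rot u]
    simp
  have h1 := sum_subtype_lt_involutive D.edge_edge D.edge_ne hf g
  have h2 := sum_subtype_lt_involutive (D.turn_turn hD) (D.turn_ne hD) hf h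
  rw [hh, ← h1] at h2
  simp only [dotProduct, Fintype.sum_sum_type]
  rw [← sub_eq_zero] at h2
  rw [← neg_eq_zero, ← h2, sub_eq_add_neg, neg_add, add_comm, ← Finset.sum_neg_distrib,
    ← Finset.sum_neg_distrib, ← Finset.sum_neg_distrib]
  congr 1
  · refine Finset.sum_congr rfl fun ⟨d, _⟩ _ => ?_
    simp only [coloringRelation, Sum.elim_inr, coloringSystem, LinearMap.coe_mk, AddHom.coe_mk]
    rcases D.isSubdivision_or_isCrossing hD d with hd | hd
    · have hr := hd.rot.not_isCrossing
      simp only [hd.vertexForm_eq, hd.not_isCrossing, h, u, g, hd.turn_eq, hd.2, hr, false_and,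
        if_false, (hσ d).2]
      push_cast
      ring
    · by_cases ho : D.isOver d
      · simp only [hd, ho, hd.turn_eq, hd.rot, hd.rot.rot, hd.rot.rot.rot, hd.isOver_rot,
          hd.rot.isOver_rot, hd.rot.rot.isOver_rot, and_self, and_false, if_true,
          not_true_eq_false, not_false_eq_true, h, u, if_false]
        push_cast
        ring
      · simp only [hd.vertexForm_of_not_isOver ho, hd, ho, hd.turn_eq, hd.rot, hd.rot.rot,
          hd.rot.rot.rot, hd.isOver_rot,
          hd.rot.isOver_rot, hd.rot.rot.isOver_rot, and_self, and_false, if_true,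
          not_true_eq_false, not_false_eq_true, h, u, if_false, g, (hσ _).2, neg_neg]
        push_cast
        ring
  · refine Finset.sum_congr rfl fun ⟨d, _⟩ _ => ?_
    simp only [coloringRelation, Sum.elim_inl, coloringSystem, LinearMap.coe_mk, AddHom.coe_mk, g,
      (hσ d).1]
    push_cast
    ring

open Classical in
/-- The right hand sides of the equations of a coloring, in multiples of `π`. -/
noncomputable def coloringConst (p : D.Dart → Prop) (f : D.Dart → ℕ) :
    {d // f d < f (D.edge d)} ⊕ {d // f d < f (D.turn d)} → ℤ :=
  Sum.elim (fun _ => 1) (fun d => D.vertexConst 1 (fun d => if p d then 0 else 1) d)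

-- The parity is read off from the double modulo 4, where the signs `σ` disappear. Only the edges
-- and the subdivision points outside `p` have a nonzero product of coefficient and constant, so the
-- double is the number of all darts plus the number of darts at those points. The latter darts are
-- thus counted twice and come in pairs, a crossing has four darts, and the darts at the points in
-- `p` are divisible by four in number.
open Classical in
theorem even_coloringRelation_dotProduct [Fintype D.Dart] (hD : ∀ d, D.isLink d)
    (σ : D.Dart → ℤˣ) {f : D.Dart → ℕ} (hf : Function.Injective f) {p : D.Dart → Prop}
    (hp : ∀ d, D.IsSubdivision d → (p (D.rot d) ↔ p d))
    (hcard : 4 ∣ Nat.card {d // D.IsSubdivision d ∧ p d}) :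
    Even (D.coloringRelation σ f ⬝ᵥ D.coloringConst p f) := by
  have hunit : ∀ x : ℤˣ, (2 : ZMod 4) * ((x : ℤ) : ZMod 4) = 2 := by
    intro x
    rcases Int.units_eq_one_or x with rfl | rfl <;> decide
  let n : D.Dart → ZMod 4 := fun d => if D.IsSubdivision d ∧ ¬ p d then 1 else 0
  let m : D.Dart → ZMod 4 := fun d => if D.IsSubdivision d ∧ p d then 1 else 0
  let o : D.Dart → ZMod 4 := fun d => if D.IsCrossing d ∧ D.isOver d then 1 else 0
  have hn : ∀ d, n (D.turn d) = n d := by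
    intro d
    rcases D.isSubdivision_or_isCrossing hD d with hd | hd
    · simp only [n, hd.turn_eq, hd, hd.rot, hp d hd]
    · simp only [n, hd.turn_eq, hd.not_isSubdivision,
        hd.rot.rot.not_isSubdivision, false_and]
  have ho : ∀ d, o (D.turn d) = o d := by
    intro d
    rcases D.isSubdivision_or_isCrossing hD d with hd | hd
    · simp only [o, hd.turn_eq, hd.not_isCrossing, hd.rot.not_isCrossing, false_and]
    · simp only [o, hd.turn_eq, hd, hd.rot.rot, hd.isOver_rot_rot]
  -- At a crossing exactly one of `d` and `D.rot d` is an upper dart.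
  have hone : ∀ d, (1 : ZMod 4) = n d + m d + (o d + o (D.rot d)) := by
    intro d
    rcases D.isSubdivision_or_isCrossing hD d with hd | hd
    · by_cases hpd : p d <;>
        simp [n, m, o, hd, hd.not_isCrossing, hd.rot.not_isCrossing, hpd]
    · have := hd.not_isSubdivision
      by_cases hod : D.isOver d <;>
        simp [n, m, o, hd, hd.rot, hd.isOver_rot, this, hod]
  have hm : ∑ d, m d = 0 := by
    rw [Finset.sum_boole, ← Fintype.card_subtype, ← Nat.card_eq_fintype_card]
    exact (ZMod.natCast_eq_zero_iff _ _).mpr hcard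
  have h4 : ∀ x : ZMod 4, x + x + (x + x) = 0 := by decide
  have hsum : ∀ g : D.Dart → ZMod 4, (∀ d, g (D.turn d) = g d) → ∑ d, (g d + g d) = 0 := by
    intro g hg
    rw [← sum_subtype_lt_involutive (D.turn_turn hD) (D.turn_ne hD) hf]
    simp [hg, h4]
  have h1 := sum_subtype_lt_involutive D.edge_edge D.edge_ne hf (fun _ => (1 : ZMod 4))
  have h2 := sum_subtype_lt_involutive (D.turn_turn hD) (D.turn_ne hD) hf n
  have hz : ((2 * (D.coloringRelation σ f ⬝ᵥ D.coloringConst p f) : ℤ) : ZMod 4) = 0 := by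
    have : ((2 * (D.coloringRelation σ f ⬝ᵥ D.coloringConst p f) : ℤ) : ZMod 4) =
        ∑ _d : D.Dart, (1 : ZMod 4) + ∑ d, n d := by
      rw [← h1, ← h2]
      simp only [dotProduct, Fintype.sum_sum_type]
      push_cast
      rw [mul_add, Finset.mul_sum, Finset.mul_sum]
      congr 1
      · refine Finset.sum_congr rfl fun ⟨d, _⟩ _ => ?_
        simp only [coloringRelation, coloringConst, Sum.elim_inl, Int.cast_one, mul_one, hunit]
        norm_num
      · refine Finset.sum_congr rfl fun ⟨d, _⟩ _ => ?_
        simp only [coloringRelation, coloringConst, Sum.elim_inr, hn]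
        rcases D.isSubdivision_or_isCrossing hD d with hd | hd
        · have hu := hunit (-σ d)
          push_cast at hu
          by_cases hpd : p d
          · simp [n, hd.vertexConst_eq, hpd]
          · simp only [n, hd.vertexConst_eq, hpd, hd, hd.not_isCrossing, false_and, if_false,
              not_false_eq_true, and_self, if_true, Int.cast_one, mul_one, Int.cast_neg, hu]
            norm_num
        · have := hd.not_isSubdivision
          by_cases hod : D.isOver d
          · simp [n, hd, hod, this]
          · simp [n, hd.vertexConst_of_not_isOver hod, this]
    rw [this, ← Finset.sum_add_distrib]
    calc ∑ d, (1 + n d) = ∑ d, ((n d + n d) + m d + (o d + o (D.rot d))) :=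
          Finset.sum_congr rfl fun d _ => by
            rw [hone d]
            ring
      _ = ∑ d, (n d + n d) + ∑ d, m d + ∑ d, (o d + o d) := by
          rw [Finset.sum_add_distrib, Finset.sum_add_distrib, Finset.sum_add_distrib (f := o),
            Finset.sum_add_distrib (f := o), Equiv.sum_comp D.rot o]
      _ = 0 := by rw [hsum n hn, hm, hsum o ho, add_zero, add_zero]
  have := (ZMod.intCast_zmod_eq_zero_iff_dvd _ 4).mp hz
  rw [even_iff_two_dvd]
  push_cast at this
  omega

open Classical in
/-- On the diagram of a link with nonvanishing determinant, whose regions have an alternating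
colouring, the equations for the angles of marked binary dihedral representations have a
solution. -/
theorem exists_isColoring (hD : ∀ d, D.isLink d) (hdet : D.determinant ≠ 0) {σ : D.Dart → ℤˣ}
    (hσ : ∀ d, σ (D.edge d) = -σ d ∧ σ (D.rot d) = -σ d) {p : D.Dart → Prop}
    (hp : ∀ d, D.IsSubdivision d → (p (D.rot d) ↔ p d))
    (hcard : 4 ∣ Nat.card {d // D.IsSubdivision d ∧ p d}) :
    ∃ θ, D.IsColoring (Real.pi : Real.Angle) (fun d => if p d then 0 else Real.pi) θ := by
  rcases isEmpty_or_nonempty D.Dart with hX | ⟨⟨d₁⟩⟩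
  · exact ⟨fun _ => 0, hX.elim, fun d => hX.elim d, fun d => hX.elim d, fun d => hX.elim d⟩
  have : Nonempty D.Dart := ⟨d₁⟩
  let : Fintype D.Dart := Fintype.ofFinite _
  obtain ⟨f, hf⟩ : ∃ f : D.Dart → ℕ, Function.Injective f :=
    ⟨fun d => Finite.equivFin D.Dart d,
      fun _ _ h => (Finite.equivFin D.Dart).injective (Fin.ext h)⟩
  let k : {d // f d < f (D.edge d)} ⊕ {d // f d < f (D.turn d)} → ℤ := D.coloringRelation σ f
  let b : {d // f d < f (D.edge d)} ⊕ {d // f d < f (D.turn d)} → ℤ := D.coloringConst p f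
  obtain ⟨z, hz⟩ := D.even_coloringRelation_dotProduct hD σ hf hp hcard
  -- Any edge equation has coefficient ±1 in the relation.
  obtain ⟨i₀, hi₀⟩ : ∃ i₀, k i₀ * k i₀ = 1 := by
    have : ∀ d, ((σ d : ℤ) * (σ d : ℤ)) = 1 := fun d => by
      rcases Int.units_eq_one_or (σ d) with h | h <;> rw [h] <;> rfl
    rcases lt_trichotomy (f d₁) (f (D.edge d₁)) with h | h | h
    · exact ⟨Sum.inl ⟨d₁, h⟩, this _⟩
    · exact absurd (hf h).symm (D.edge_ne d₁)
    · exact ⟨Sum.inl ⟨D.edge d₁, by rwa [D.edge_edge]⟩, this _⟩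
  -- Since `k ⬝ᵥ b = 2 * z`, this change of one entry by an even integer makes the relation hold
  -- exactly; after multiplication by π it is invisible modulo 2π.
  let b' : {d // f d < f (D.edge d)} ⊕ {d // f d < f (D.turn d)} → ℤ :=
    b - Pi.single i₀ (2 * z * k i₀)
  have hb' : k ⬝ᵥ b' = 0 := by
    rw [dotProduct_sub, dotProduct_single]
    change D.coloringRelation σ f ⬝ᵥ D.coloringConst p f - _ = 0
    rw [hz]
    linear_combination (-2 * z) * hi₀
  obtain ⟨θ, hθ⟩ := exists_solution_of_relation (D.coloringSystem f)
    (by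
      have h1 := card_subtype_lt_involutive D.edge_edge D.edge_ne hf
      have h2 := card_subtype_lt_involutive (D.turn_turn hD) (D.turn_ne hD) hf
      rw [Fintype.card_sum]
      omega)
    (D.finrank_ker_coloringSystem_le hD hdet hf)
    (k := fun r => (k r : ℝ)) (β := fun r => (b' r : ℝ) * Real.pi)
    (fun h => by
      have h0 : (k i₀ : ℝ) = 0 := congrFun h i₀
      rw [Int.cast_eq_zero] at h0
      rw [h0] at hi₀
      exact absurd hi₀ (by norm_num))
    (D.coloringRelation_dotProduct hD hσ hf)
    (by
      have : (((k ⬝ᵥ b' : ℤ) : ℝ)) * Real.pi = 0 := by rw [hb']; simp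
      rw [← this]
      simp only [dotProduct]
      push_cast
      rw [Finset.sum_mul]
      exact Finset.sum_congr rfl fun _ _ => by ring)
  have hπ : (Real.pi : Real.Angle) + Real.pi = 0 := Real.Angle.coe_pi_add_coe_pi
  have hθ' : ∀ r, ((D.coloringSystem f θ r : ℝ) : Real.Angle) = b r • (Real.pi : Real.Angle) := by
    intro r
    rw [hθ, Real.Angle.intCast_mul_eq_zsmul]
    simp only [b', Pi.sub_apply, sub_smul]
    rw [sub_eq_self, Pi.single_apply]
    split_ifs
    · rw [mul_comm, mul_smul, mul_comm 2 z, mul_smul, Real.Angle.two_zsmul_coe_pi, smul_zero,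
        smul_zero]
    · exact zero_smul _ _
  refine ⟨fun d => (θ d : Real.Angle), D.isColoring_of_vertexForm hD hf hπ ?_ ?_ ?_ ?_⟩
  · intro d
    by_cases h : p d <;> simp [h, hπ]
  · intro d hd
    simp [hp d hd]
  · intro d hd
    have := hθ' (Sum.inl ⟨d, hd⟩)
    simpa [coloringSystem, b, coloringConst] using this
  · intro d hd
    have := hθ' (Sum.inr ⟨d, hd⟩)
    simp only [coloringSystem, LinearMap.coe_mk, AddHom.coe_mk, Sum.elim_inr, b,
      coloringConst] at this
    rcases D.isSubdivision_or_isCrossing hD d with hd | hd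
    · rw [hd.vertexForm_eq, hd.vertexConst_eq] at this ⊢
      by_cases h : p d <;> simpa [h] using this
    · by_cases ho : D.isOver d
      · rw [hd.vertexForm_of_isOver ho, hd.vertexConst_of_isOver ho] at this ⊢
        simpa using this
      · rw [hd.vertexForm_of_not_isOver ho, hd.vertexConst_of_not_isOver ho] at this ⊢
        simpa using this

end MarkedLinkDiagram

/-! ### Angles of elements of the binary dihedral group -/

theorem quatExpI_zero : quatExpI 0 = 1 := by
  ext <;> simp [quatExpI]

theorem quatExpI_inj {a b : ℝ} : quatExpI a = quatExpI b ↔ (a : Real.Angle) = b := by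
  constructor
  · intro h
    exact Real.Angle.cos_sin_inj (congrArg QuaternionAlgebra.re h) (congrArg QuaternionAlgebra.imI h)
  · intro h
    unfold quatExpI
    rw [← Real.Angle.cos_coe, ← Real.Angle.sin_coe, h, Real.Angle.cos_coe, Real.Angle.sin_coe]

theorem quatExpI_mem_unitary (a : ℝ) : quatExpI a ∈ unitary ℍ[ℝ] := by
  constructor <;> simp [star_quatExpI, quatExpI_mul, quatExpI_zero]

theorem quatJ_mem_unitary : quatJ ∈ unitary ℍ[ℝ] := by
  constructor
  · rw [star_quatJ, mul_assoc, quatExpI_mul_quatJ, ← mul_assoc, quatJ_mul_quatJ, quatExpI_mul]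
    simp [quatExpI_zero]
  · rw [star_quatJ, ← mul_assoc, quatJ_mul_quatJ, quatExpI_mul, ← quatExpI_zero, quatExpI_inj]
    simp

namespace binaryDihedral

/-- The element `e^{Ia}`. -/
noncomputable def expA (a : Real.Angle) : binaryDihedral :=
  ⟨⟨quatExpI a.toReal, quatExpI_mem_unitary _⟩, Or.inl ⟨_, rfl⟩⟩

/-- The element `J e^{Ia}`. -/
noncomputable def expB (a : Real.Angle) : binaryDihedral :=
  ⟨⟨quatJ * quatExpI a.toReal, mul_mem quatJ_mem_unitary (quatExpI_mem_unitary _)⟩,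
    Or.inr ⟨_, rfl⟩⟩

theorem coe_injective {g h : binaryDihedral}
    (H : ((g : unitary ℍ[ℝ]) : ℍ[ℝ]) = ((h : unitary ℍ[ℝ]) : ℍ[ℝ])) : g = h :=
  Subtype.ext (Subtype.ext H)

theorem expA_mul_expA (a b : Real.Angle) : expA a * expA b = expA (a + b) := by
  apply coe_injective
  change quatExpI _ * quatExpI _ = quatExpI _
  rw [quatExpI_mul, quatExpI_inj]
  simp

theorem expB_mul_expA (a b : Real.Angle) : expB a * expA b = expB (a + b) := by
  apply coe_injective
  change quatJ * quatExpI _ * quatExpI _ = quatJ * quatExpI _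
  rw [mul_assoc, quatExpI_mul]
  congr 1
  rw [quatExpI_inj]
  simp

theorem expA_mul_expB (a b : Real.Angle) : expA a * expB b = expB (b - a) := by
  apply coe_injective
  change quatExpI _ * (quatJ * quatExpI _) = quatJ * quatExpI _
  rw [← mul_assoc, quatExpI_mul_quatJ, mul_assoc, quatExpI_mul]
  congr 1
  rw [quatExpI_inj]
  simp [sub_eq_neg_add]

theorem expB_mul_expB (a b : Real.Angle) : expB a * expB b = expA (Real.pi - a + b) := by
  apply coe_injective
  change quatJ * quatExpI _ * (quatJ * quatExpI _) = quatExpI _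
  rw [mul_assoc, ← mul_assoc (quatExpI _), quatExpI_mul_quatJ, mul_assoc, quatExpI_mul,
    ← mul_assoc, quatJ_mul_quatJ, quatExpI_mul, quatExpI_inj]
  simp only [Real.Angle.coe_add, Real.Angle.coe_neg, Real.Angle.coe_toReal]
  abel

theorem expA_eq_one {a : Real.Angle} : expA a = 1 ↔ a = 0 := by
  constructor
  · intro h
    have h' : quatExpI a.toReal = 1 :=
      congrArg (fun g : binaryDihedral => ((g : unitary ℍ[ℝ]) : ℍ[ℝ])) h
    rw [← quatExpI_zero, quatExpI_inj] at h'
    simpa using h'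
  · rintro rfl
    apply coe_injective
    change quatExpI _ = 1
    rw [Real.Angle.toReal_zero, quatExpI_zero]

theorem expA_inv (a : Real.Angle) : (expA a)⁻¹ = expA (-a) := by
  rw [inv_eq_iff_mul_eq_one, expA_mul_expA, expA_eq_one, add_neg_cancel]

theorem expB_injective : Function.Injective expB := by
  intro a b h
  have h2 : expA (Real.pi - b + b) = expA (Real.pi - b + a) := by
    rw [← expB_mul_expB b b, ← expB_mul_expB b a, h]
  have h3 : expA (-(Real.pi - b + b) + (Real.pi - b + a)) = 1 := by
    rw [← expA_mul_expA, ← expA_inv, h2, inv_mul_cancel]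
  rw [expA_eq_one] at h3
  rw [← sub_eq_zero, ← h3]
  abel

theorem mem_circleA_iff {g : binaryDihedral} :
    ((g : unitary ℍ[ℝ]) : ℍ[ℝ]) ∈ circleA ↔ ∃ a, g = expA a := by
  constructor
  · rintro ⟨a, ha⟩
    refine ⟨a, coe_injective ?_⟩
    rw [ha]
    exact quatExpI_inj.mpr (by simp)
  · rintro ⟨a, rfl⟩
    exact ⟨_, rfl⟩

theorem mem_circleB_iff {g : binaryDihedral} :
    ((g : unitary ℍ[ℝ]) : ℍ[ℝ]) ∈ circleB ↔ ∃ a, g = expB a := by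
  constructor
  · rintro ⟨a, ha⟩
    refine ⟨a, coe_injective ?_⟩
    rw [ha]
    exact congrArg (quatJ * ·) (quatExpI_inj.mpr (by simp))
  · rintro ⟨a, rfl⟩
    exact ⟨_, rfl⟩

theorem coe_expA_pi : ((expA Real.pi : unitary ℍ[ℝ]) : ℍ[ℝ]) = -1 := by
  change quatExpI _ = -1
  rw [Real.Angle.toReal_pi]
  ext <;> simp [quatExpI]

theorem eq_neg_one_iff {g : binaryDihedral} :
    ((g : unitary ℍ[ℝ]) : ℍ[ℝ]) = -1 ↔ g = expA Real.pi := by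
  rw [← coe_expA_pi]
  exact ⟨coe_injective, fun h => by rw [h]⟩

open Real.Angle in
theorem expA_pi_mul_self : expA Real.pi * expA Real.pi = 1 := by
  rw [expA_mul_expA, expA_eq_one, coe_pi_add_coe_pi]

theorem expA_pi_mul_comm (g : binaryDihedral) : expA Real.pi * g = g * expA Real.pi := by
  apply coe_injective
  change ((expA Real.pi : unitary ℍ[ℝ]) : ℍ[ℝ]) * _ = _ * ((expA Real.pi : unitary ℍ[ℝ]) : ℍ[ℝ])
  rw [coe_expA_pi]
  simp

/-- In this and the following criteria the square `J² = -1` contributes π to the relation between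
the angles. A single factor `expA π` cancels this contribution, and two such factors have no effect.
-/
theorem expB_mul_expB_eq_one {a b : Real.Angle} : expB a * expB b = 1 ↔ b = a + Real.pi := by
  rw [expB_mul_expB, expA_eq_one, ← sub_eq_zero (a := b), ← Real.Angle.sub_coe_pi_eq_add_coe_pi]
  rw [show b - (a - Real.pi) = Real.pi - a + b by abel]

theorem expB_mul_expB_mul_expA_pi {a b : Real.Angle} :
    expB a * expB b * expA Real.pi = 1 ↔ b = a := by
  rw [expB_mul_expB, expA_mul_expA, expA_eq_one, ← sub_eq_zero (a := b),
    show Real.pi - a + b + Real.pi = b - a + (Real.pi + Real.pi) by abel,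
    Real.Angle.coe_pi_add_coe_pi, add_zero]

theorem expB_mul_expA_pi_mul_expB {a b : Real.Angle} :
    expB a * expA Real.pi * expB b = 1 ↔ b = a := by
  rw [mul_assoc, expA_pi_mul_comm, ← mul_assoc, expB_mul_expB_mul_expA_pi]

theorem expA_pi_mul_expB_mul_expB {a b : Real.Angle} :
    expA Real.pi * expB a * expB b = 1 ↔ b = a := by
  rw [mul_assoc, expA_pi_mul_comm, expB_mul_expB_mul_expA_pi]

theorem expB_mul_expA_pi_alternating {a b : Real.Angle} :
    expB a * expA Real.pi * expB b * expA Real.pi = 1 ↔ b = a + Real.pi := by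
  rw [mul_assoc _ _ (expB b), expA_pi_mul_comm, ← mul_assoc, mul_assoc _ (expA _), expA_pi_mul_self,
    mul_one, expB_mul_expB_eq_one]

theorem expA_pi_mul_expB_alternating {a b : Real.Angle} :
    expA Real.pi * expB a * expA Real.pi * expB b = 1 ↔ b = a + Real.pi := by
  rw [expA_pi_mul_comm, mul_assoc (expB a), expA_pi_mul_self, mul_one, expB_mul_expB_eq_one]

theorem expB_mul_four {a b c d : Real.Angle} :
    expB a * expB b * expB c * expB d = 1 ↔ a - b + c - d = 0 := by
  rw [mul_assoc (expB a * expB b), expB_mul_expB, expB_mul_expB, expA_mul_expA, expA_eq_one,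
    ← neg_eq_zero (a := a - b + c - d),
    show Real.pi - a + b + (Real.pi - c + d) = -(a - b + c - d) + (Real.pi + Real.pi) by abel,
    Real.Angle.coe_pi_add_coe_pi, add_zero]

end binaryDihedral

/-! ### Representations as colorings of the erased diagram -/

namespace MarkedLinkDiagram

variable {D : MarkedLinkDiagram}

theorem coe_erase_rot_of_isLink {d : D.erase.Dart} (h : D.isLink (D.rot d.1)) :
    (D.erase.rot d).1 = D.rot d.1 :=
  congrArg Subtype.val (D.linkRot_of_isLink d h)

theorem coe_erase_rot_of_not_isLink {d : D.erase.Dart} (h : ¬ D.isLink (D.rot d.1)) :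
    (D.erase.rot d).1 = D.rot (D.rot d.1) :=
  congrArg Subtype.val (D.linkRot_of_not_isLink d h)

theorem IsSubdivision.isLink_rot_iff {d : D.Dart} (h : D.IsSubdivision d) :
    D.isLink (D.rot d) ↔ D.isLink d := by
  rcases D.vertex_cases d with ⟨-, -, h'⟩ | ⟨h1, h2, -⟩ | ⟨h1, h2, -⟩
  · exact h'
  · exact absurd h (IsEndpoint.not_isSubdivision ⟨h1, h2⟩)
  · exact absurd ⟨h1, h2⟩ h.not_isCrossing

theorem IsCrossing.isLink_rot_rot_iff {d : D.Dart} (h : D.IsCrossing d) :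
    D.isLink (D.rot (D.rot d)) ↔ D.isLink d := by
  rcases D.vertex_cases d with ⟨h1, h2, -⟩ | ⟨h1, h2, -⟩ | ⟨-, -, h', -⟩
  · exact absurd h (IsSubdivision.not_isCrossing ⟨h1, h2⟩)
  · exact absurd h (IsEndpoint.not_isCrossing ⟨h1, h2⟩)
  · exact h'

theorem IsEndpoint.isLink_cases {d : D.Dart} (h : D.IsEndpoint d) :
    (¬ D.isLink d ∧ D.isLink (D.rot d) ∧ D.isLink (D.rot (D.rot d))) ∨
    (D.isLink d ∧ ¬ D.isLink (D.rot d) ∧ D.isLink (D.rot (D.rot d))) ∨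
    (D.isLink d ∧ D.isLink (D.rot d) ∧ ¬ D.isLink (D.rot (D.rot d))) := by
  rcases D.vertex_cases d with ⟨h1, h2, -⟩ | ⟨-, -, h'⟩ | ⟨h1, h2, -⟩
  · exact absurd ⟨h1, h2⟩ h.not_isSubdivision
  · exact h'
  · exact absurd ⟨h1, h2⟩ h.not_isCrossing

variable (D) in
theorem isSubdivision_or_isEndpoint_or_isCrossing (d : D.Dart) :
    D.IsSubdivision d ∨ D.IsEndpoint d ∨ D.IsCrossing d := by
  rcases D.vertex_cases d with ⟨h1, h2, -⟩ | ⟨h1, h2, -⟩ | ⟨h1, h2, -⟩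
  · exact Or.inl ⟨h1, h2⟩
  · exact Or.inr (Or.inl ⟨h1, h2⟩)
  · exact Or.inr (Or.inr ⟨h1, h2⟩)

theorem isSubdivision_erase_of_isSubdivision {d : D.erase.Dart} (h : D.IsSubdivision d.1) :
    D.erase.IsSubdivision d := by
  have hl := h.isLink_rot_iff.mpr d.2
  have e1 := coe_erase_rot_of_isLink hl
  have e2 : (D.erase.rot (D.erase.rot d)).1 = D.rot (D.rot d.1) := by
    rw [coe_erase_rot_of_isLink, e1]
    rw [e1, h.2]; exact d.2
  exact ⟨fun h' => h.1 (by rw [← e1, h']), Subtype.ext (e2.trans h.2)⟩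

theorem isSubdivision_erase_of_isEndpoint {d : D.erase.Dart} (h : D.IsEndpoint d.1) :
    D.erase.IsSubdivision d := by
  have h2 : D.rot (D.rot d.1) ≠ d.1 := fun h2 => h.not_isSubdivision ⟨h.1, h2⟩
  rcases h.isLink_cases with ⟨hn, -⟩ | ⟨-, hn, hl⟩ | ⟨-, hl, hn⟩
  · exact absurd d.2 hn
  · have e1 := coe_erase_rot_of_not_isLink hn
    have e2 : (D.erase.rot (D.erase.rot d)).1 = D.rot (D.rot (D.rot d.1)) := by
      rw [coe_erase_rot_of_isLink, e1]
      rw [e1, h.2]; exact d.2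
    exact ⟨fun h' => h2 (by rw [← e1, h']), Subtype.ext (e2.trans h.2)⟩
  · have e1 := coe_erase_rot_of_isLink hl
    have e2 : (D.erase.rot (D.erase.rot d)).1 = D.rot (D.rot (D.rot d.1)) := by
      rw [coe_erase_rot_of_not_isLink, e1]
      rw [e1]; exact hn
    exact ⟨fun h' => h.1 (by rw [← e1, h']), Subtype.ext (e2.trans h.2)⟩

theorem isSubdivision_erase_of_isCrossing {d : D.erase.Dart} (h : D.IsCrossing d.1)
    (hn : ¬ D.isLink (D.rot d.1)) : D.erase.IsSubdivision d := by
  have e1 := coe_erase_rot_of_not_isLink hn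
  have e2 : (D.erase.rot (D.erase.rot d)).1 = D.rot (D.rot (D.rot (D.rot d.1))) := by
    rw [coe_erase_rot_of_not_isLink, e1]
    rw [e1]; exact mt h.rot.isLink_rot_rot_iff.mp hn
  exact ⟨fun h' => h.1 (by rw [← e1, h']), Subtype.ext (e2.trans h.2)⟩

theorem coe_erase_rot_rot {d : D.erase.Dart} (h : D.IsCrossing d.1) (hl : D.isLink (D.rot d.1)) :
    (D.erase.rot (D.erase.rot d)).1 = D.rot (D.rot d.1) := by
  have e1 := coe_erase_rot_of_isLink hl
  rw [coe_erase_rot_of_isLink, e1]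
  rw [e1]; exact h.isLink_rot_rot_iff.mpr d.2

theorem coe_erase_rot_rot_rot {d : D.erase.Dart} (h : D.IsCrossing d.1)
    (hl : D.isLink (D.rot d.1)) :
    (D.erase.rot (D.erase.rot (D.erase.rot d))).1 = D.rot (D.rot (D.rot d.1)) := by
  have e1 := coe_erase_rot_of_isLink hl
  rw [coe_erase_rot_rot, e1]
  · rw [e1]; exact h.rot
  · rw [e1]; exact h.isLink_rot_rot_iff.mpr d.2

theorem isCrossing_erase_iff {d : D.erase.Dart} :
    D.erase.IsCrossing d ↔ D.IsCrossing d.1 ∧ D.isLink (D.rot d.1) := by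
  constructor
  · intro h
    have h' := h.not_isSubdivision
    rcases D.isSubdivision_or_isEndpoint_or_isCrossing d.1 with hd | hd | hd
    · exact absurd (isSubdivision_erase_of_isSubdivision hd) h'
    · exact absurd (isSubdivision_erase_of_isEndpoint hd) h'
    · refine ⟨hd, ?_⟩
      by_contra hn
      exact h' (isSubdivision_erase_of_isCrossing hd hn)
  · rintro ⟨h, hl⟩
    have e2 := coe_erase_rot_rot h hl
    have e3 := coe_erase_rot_rot_rot h hl
    have e4 : (D.erase.rot (D.erase.rot (D.erase.rot (D.erase.rot d)))).1 =
        D.rot (D.rot (D.rot (D.rot d.1))) := by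
      rw [coe_erase_rot_of_isLink, e3]
      rw [e3, h.2]; exact d.2
    exact ⟨fun h' => h.1 (by rw [← e2, h']), Subtype.ext (e4.trans h.2)⟩

open Classical in
/-- The images of the meridians under the marked representation with given angles. -/
noncomputable def meridianImage (θ : D.erase.Dart → Real.Angle) (d : D.Dart) : binaryDihedral :=
  if h : D.isLink d then binaryDihedral.expB (θ ⟨d, h⟩) else binaryDihedral.expA Real.pi

theorem meridianImage_eq {θ : D.erase.Dart → Real.Angle} {d : D.Dart} {d' : D.erase.Dart}
    (h : d'.1 = d) : meridianImage θ d = binaryDihedral.expB (θ d') := by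
  subst h
  exact dif_pos d'.2

theorem meridianImage_of_not_isLink {θ : D.erase.Dart → Real.Angle} {d : D.Dart}
    (h : ¬ D.isLink d) : meridianImage θ d = binaryDihedral.expA Real.pi :=
  dif_neg h

open Classical in
variable (D) in
/-- The change of the angle at the subdivision points that are left when `ω` is erased. -/
noncomputable def endpointShift (d : D.erase.Dart) : Real.Angle :=
  if D.IsEndpoint d.1 then 0 else Real.pi

theorem endpointShift_of_isEndpoint {d : D.erase.Dart} (h : D.IsEndpoint d.1) :
    D.endpointShift d = 0 :=
  if_pos h

theorem endpointShift_of_not_isEndpoint {d : D.erase.Dart} (h : ¬ D.IsEndpoint d.1) :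
    D.endpointShift d = Real.pi :=
  if_neg h

open binaryDihedral

/-- A subdivision point of the erased diagram has three possible origins. At an old subdivision
point no meridian of `ω` occurs, and at a crossing with `ω` two of them cancel, so the shift is π;
at an end point a single -1 remains and the shift is 0. -/
theorem isColoring_of_relator {θ : D.erase.Dart → Real.Angle}
    (h : ∀ r, D.Relator r → FreeGroup.lift (meridianImage θ) r = 1) :
    D.erase.IsColoring (Real.pi : Real.Angle) D.endpointShift θ := by
  refine ⟨fun d => ?_, fun d hd => ?_, fun d hd ho => ?_, fun d hd => ?_⟩
  · have := h _ (.edge d.1)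
    simp only [map_mul, FreeGroup.lift_apply_of] at this
    rwa [meridianImage_eq (d' := d) rfl, meridianImage_eq (D.coe_edge_erase d),
      expB_mul_expB_eq_one] at this
  · rcases D.isSubdivision_or_isEndpoint_or_isCrossing d.1 with hs | hs | hs
    · rw [endpointShift_of_not_isEndpoint fun h => h.not_isSubdivision hs]
      have := h _ (.subdivision d.1 hs)
      simp only [map_mul, FreeGroup.lift_apply_of] at this
      rwa [meridianImage_eq (d' := d) rfl,
        meridianImage_eq (coe_erase_rot_of_isLink (hs.isLink_rot_iff.mpr d.2)),
        expB_mul_expB_eq_one] at this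
    · rw [endpointShift_of_isEndpoint hs, add_zero]
      have := h _ (.endpoint d.1 hs)
      simp only [map_mul, FreeGroup.lift_apply_of] at this
      rcases hs.isLink_cases with ⟨hn, -⟩ | ⟨-, hn, hl⟩ | ⟨-, hl, hn⟩
      · exact absurd d.2 hn
      · rwa [meridianImage_eq (d' := d) rfl, meridianImage_of_not_isLink hn,
          meridianImage_eq (coe_erase_rot_of_not_isLink hn), expB_mul_expA_pi_mul_expB] at this
      · rwa [meridianImage_eq (d' := d) rfl, meridianImage_eq (coe_erase_rot_of_isLink hl),
          meridianImage_of_not_isLink hn, expB_mul_expB_mul_expA_pi] at this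
    · have hn : ¬ D.isLink (D.rot d.1) := fun hl =>
        hd.not_isCrossing (isCrossing_erase_iff.mpr ⟨hs, hl⟩)
      rw [endpointShift_of_not_isEndpoint fun h => h.not_isCrossing hs]
      have := h _ (.crossing d.1 hs)
      simp only [map_mul, FreeGroup.lift_apply_of] at this
      rwa [meridianImage_eq (d' := d) rfl, meridianImage_of_not_isLink hn,
        meridianImage_eq (coe_erase_rot_of_not_isLink hn),
        meridianImage_of_not_isLink (mt hs.rot.isLink_rot_rot_iff.mp hn),
        expB_mul_expA_pi_alternating] at this
  · obtain ⟨hc, hl⟩ := isCrossing_erase_iff.mp hd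
    have := h _ (.over d.1 hc ho)
    simp only [map_mul, FreeGroup.lift_apply_of] at this
    rwa [meridianImage_eq (d' := d) rfl, meridianImage_eq (coe_erase_rot_rot hc hl),
      expB_mul_expB_eq_one] at this
  · obtain ⟨hc, hl⟩ := isCrossing_erase_iff.mp hd
    have := h _ (.crossing d.1 hc)
    simp only [map_mul, FreeGroup.lift_apply_of] at this
    rwa [meridianImage_eq (d' := d) rfl, meridianImage_eq (coe_erase_rot_of_isLink hl),
      meridianImage_eq (coe_erase_rot_rot hc hl), meridianImage_eq (coe_erase_rot_rot_rot hc hl),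
      expB_mul_four] at this

theorem IsColoring.relator {θ : D.erase.Dart → Real.Angle}
    (h : D.erase.IsColoring (Real.pi : Real.Angle) D.endpointShift θ) :
    ∀ r, D.Relator r → FreeGroup.lift (meridianImage θ) r = 1 := by
  rintro _ (d | ⟨d, hs⟩ | ⟨d, hs⟩ | ⟨d, hs, ho⟩ | ⟨d, hs⟩) <;>
    simp only [map_mul, FreeGroup.lift_apply_of]
  · by_cases hl : D.isLink d
    · let d' : D.erase.Dart := ⟨d, hl⟩
      rw [meridianImage_eq (d' := d') rfl, meridianImage_eq (D.coe_edge_erase d'),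
        expB_mul_expB_eq_one]
      exact h.edge d'
    · rw [meridianImage_of_not_isLink hl, meridianImage_of_not_isLink
        (mt (D.isLink_edge d).mp hl), expA_pi_mul_self]
  · by_cases hl : D.isLink d
    · let d' : D.erase.Dart := ⟨d, hl⟩
      rw [meridianImage_eq (d' := d') rfl,
        meridianImage_eq (d' := D.erase.rot d') (coe_erase_rot_of_isLink
          (hs.isLink_rot_iff.mpr hl)), expB_mul_expB_eq_one,
        h.subdivision d' (isSubdivision_erase_of_isSubdivision hs),
        endpointShift_of_not_isEndpoint fun h => h.not_isSubdivision hs]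
    · rw [meridianImage_of_not_isLink hl, meridianImage_of_not_isLink
        (mt hs.isLink_rot_iff.mp hl), expA_pi_mul_self]
  · rcases hs.isLink_cases with ⟨hn, hl, hl'⟩ | ⟨hl, hn, -⟩ | ⟨hl, hl', hn⟩
    · let d' : D.erase.Dart := ⟨D.rot d, hl⟩
      rw [meridianImage_of_not_isLink hn, meridianImage_eq (d' := d') rfl,
        meridianImage_eq (d' := D.erase.rot d') (coe_erase_rot_of_isLink hl'),
        expA_pi_mul_expB_mul_expB, h.subdivision d' (isSubdivision_erase_of_isEndpoint hs.rot),
        endpointShift_of_isEndpoint hs.rot, add_zero]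
    · let d' : D.erase.Dart := ⟨d, hl⟩
      rw [meridianImage_of_not_isLink hn, meridianImage_eq (d' := d') rfl,
        meridianImage_eq (d' := D.erase.rot d') (coe_erase_rot_of_not_isLink hn),
        expB_mul_expA_pi_mul_expB, h.subdivision d' (isSubdivision_erase_of_isEndpoint hs),
        endpointShift_of_isEndpoint hs, add_zero]
    · let d' : D.erase.Dart := ⟨d, hl⟩
      rw [meridianImage_of_not_isLink hn, meridianImage_eq (d' := d') rfl,
        meridianImage_eq (d' := D.erase.rot d') (coe_erase_rot_of_isLink hl'),
        expB_mul_expB_mul_expA_pi, h.subdivision d' (isSubdivision_erase_of_isEndpoint hs),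
        endpointShift_of_isEndpoint hs, add_zero]
  · by_cases hl : D.isLink d
    · let d' : D.erase.Dart := ⟨d, hl⟩
      rw [meridianImage_eq (d' := d') rfl]
      by_cases hr : D.isLink (D.rot d)
      · rw [meridianImage_eq (d' := D.erase.rot (D.erase.rot d')) (coe_erase_rot_rot hs hr),
          expB_mul_expB_eq_one]
        exact h.overpass d' (isCrossing_erase_iff.mpr ⟨hs, hr⟩) ho
      · rw [meridianImage_eq (d' := D.erase.rot d') (coe_erase_rot_of_not_isLink hr),
          expB_mul_expB_eq_one, h.subdivision d' (isSubdivision_erase_of_isCrossing hs hr),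
          endpointShift_of_not_isEndpoint fun h => h.not_isCrossing hs]
    · rw [meridianImage_of_not_isLink hl, meridianImage_of_not_isLink
        (mt hs.isLink_rot_rot_iff.mp hl), expA_pi_mul_self]
  · by_cases hl : D.isLink d
    · let d' : D.erase.Dart := ⟨d, hl⟩
      rw [meridianImage_eq (d' := d') rfl]
      by_cases hr : D.isLink (D.rot d)
      · rw [meridianImage_eq (d' := D.erase.rot d') (coe_erase_rot_of_isLink hr),
          meridianImage_eq (d' := D.erase.rot (D.erase.rot d')) (coe_erase_rot_rot hs hr),
          meridianImage_eq (d' := D.erase.rot (D.erase.rot (D.erase.rot d')))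
            (coe_erase_rot_rot_rot hs hr), expB_mul_four]
        exact h.crossing d' (isCrossing_erase_iff.mpr ⟨hs, hr⟩)
      · rw [meridianImage_eq (d' := D.erase.rot d') (coe_erase_rot_of_not_isLink hr),
          meridianImage_of_not_isLink hr,
          meridianImage_of_not_isLink (mt hs.rot.isLink_rot_rot_iff.mp hr),
          expB_mul_expA_pi_alternating,
          h.subdivision d' (isSubdivision_erase_of_isCrossing hs hr),
          endpointShift_of_not_isEndpoint fun h => h.not_isCrossing hs]
    · have hl' := mt hs.isLink_rot_rot_iff.mp hl
      rw [meridianImage_of_not_isLink hl, meridianImage_of_not_isLink hl']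
      by_cases hr : D.isLink (D.rot d)
      · let d' : D.erase.Dart := ⟨D.rot d, hr⟩
        rw [meridianImage_eq (d' := d') rfl,
          meridianImage_eq (d' := D.erase.rot d') (coe_erase_rot_of_not_isLink hl'),
          expA_pi_mul_expB_alternating,
          h.subdivision d' (isSubdivision_erase_of_isCrossing hs.rot hl'),
          endpointShift_of_not_isEndpoint fun h => h.not_isCrossing hs.rot]
      · rw [meridianImage_of_not_isLink hr,
          meridianImage_of_not_isLink (mt hs.rot.isLink_rot_rot_iff.mp hr), expA_pi_mul_self,
          one_mul, expA_pi_mul_self]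

/-- The marked representation with given angles. -/
noncomputable def IsColoring.toRepB {θ : D.erase.Dart → Real.Angle}
    (h : D.erase.IsColoring (Real.pi : Real.Angle) D.endpointShift θ) : D.RepB :=
  ⟨PresentedGroup.toGroup (f := meridianImage θ) h.relator, by
    constructor
    · intro d hd
      rw [mem_circleB_iff]
      refine ⟨θ ⟨d, hd⟩, ?_⟩
      rw [meridian, PresentedGroup.toGroup.of]
      exact meridianImage_eq rfl
    · intro d hd
      rw [eq_neg_one_iff, meridian, PresentedGroup.toGroup.of]
      exact meridianImage_of_not_isLink hd⟩

theorem IsColoring.toRepB_meridian {θ : D.erase.Dart → Real.Angle}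
    (h : D.erase.IsColoring (Real.pi : Real.Angle) D.endpointShift θ) (d : D.Dart) :
    h.toRepB.1 (D.meridian d) = meridianImage θ d :=
  PresentedGroup.toGroup.of h.relator

/-- The angle of the image of the meridian of a dart of `L`. -/
noncomputable def RepB.angle (ρ : D.RepB) (d : D.erase.Dart) : Real.Angle :=
  (mem_circleB_iff.mp (ρ.2.1 d.1 d.2)).choose

theorem RepB.meridian_eq (ρ : D.RepB) (d : D.Dart) :
    ρ.1 (D.meridian d) = meridianImage ρ.angle d := by
  by_cases h : D.isLink d
  · rw [meridianImage_eq (d' := ⟨d, h⟩) rfl]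
    exact (mem_circleB_iff.mp (ρ.2.1 d h)).choose_spec
  · rw [meridianImage_of_not_isLink h]
    exact eq_neg_one_iff.mp (ρ.2.2 d h)

theorem RepB.isColoring_angle (ρ : D.RepB) :
    D.erase.IsColoring (Real.pi : Real.Angle) D.endpointShift ρ.angle := by
  apply isColoring_of_relator
  intro r hr
  have : FreeGroup.lift (meridianImage ρ.angle) =
      ρ.1.comp (PresentedGroup.mk {r | D.Relator r}) := by
    ext1 d
    rw [FreeGroup.lift_apply_of, ← ρ.meridian_eq]
    rfl
  rw [this, MonoidHom.comp_apply, PresentedGroup.one_of_mem (rels := {r | D.Relator r}) hr, map_one]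

theorem IsColoring.angle_toRepB {θ : D.erase.Dart → Real.Angle}
    (h : D.erase.IsColoring (Real.pi : Real.Angle) D.endpointShift θ) :
    h.toRepB.angle = θ := by
  ext1 d
  have := h.toRepB.meridian_eq d.1
  rw [h.toRepB_meridian, meridianImage_eq (d' := d) rfl, meridianImage_eq (d' := d) rfl] at this
  exact (expB_injective this).symm

/-- Conjugation by `S¹_A` adds a constant to the angles. -/
theorem repBSetoid_iff (ρ ρ' : D.RepB) :
    D.repBSetoid ρ ρ' ↔ ∃ a, ∀ d, ρ'.angle d - ρ.angle d = a := by
  have hconj : ∀ a b, expA a * expB b * (expA a)⁻¹ = expB (b - 2 • a) := by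
    intro a b
    rw [expA_mul_expB, expA_inv, expB_mul_expA, two_nsmul, ← sub_eq_add_neg, sub_sub]
  constructor
  · rintro ⟨g, hg, h⟩
    obtain ⟨a, rfl⟩ := mem_circleA_iff.mp hg
    refine ⟨-(2 • a), fun d => ?_⟩
    have := h (D.meridian d.1)
    rw [ρ.meridian_eq, ρ'.meridian_eq, meridianImage_eq (d' := d) rfl,
      meridianImage_eq (d' := d) rfl, hconj] at this
    rw [expB_injective this]
    abel
  · rintro ⟨a, h⟩
    -- Conjugation by `expA b` subtracts `2 • b` from the angles, so the constant `a` has to be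
    -- halved, which is possible in the circle.
    let b : Real.Angle := ((-(a.toReal) / 2 : ℝ) : Real.Angle)
    have hb : 2 • b = -a := by
      rw [Real.Angle.two_nsmul_coe_div_two]
      simp
    refine ⟨expA b, mem_circleA_iff.mpr ⟨b, rfl⟩, ?_⟩
    have : ρ'.1 = (MulAut.conj (expA b)).toMonoidHom.comp ρ.1 := by
      refine PresentedGroup.ext fun d => ?_
      change ρ'.1 (D.meridian d) = expA b * ρ.1 (D.meridian d) * (expA b)⁻¹
      rw [ρ.meridian_eq, ρ'.meridian_eq]
      by_cases hl : D.isLink d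
      · rw [meridianImage_eq (d' := ⟨d, hl⟩) rfl, meridianImage_eq (d' := ⟨d, hl⟩) rfl, hconj, hb,
          ← h ⟨d, hl⟩]
        congr 1
        abel
      · rw [meridianImage_of_not_isLink hl, meridianImage_of_not_isLink hl, ← expA_pi_mul_comm,
          mul_inv_cancel_right]
    intro x
    rw [this]
    rfl

end MarkedLinkDiagram

/-! ### Classes of colorings and their comparison with `RB` -/

namespace MarkedLinkDiagram

variable {D : MarkedLinkDiagram}

section IsColoring

variable {T : Type*} [AddCommGroup T] {c c' : T} {e e' θ θ' : D.Dart → T}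

/-- Together with negation, this makes the difference of two colorings with the same constants
homogeneous. -/
theorem IsColoring.add (h : D.IsColoring c e θ) (h' : D.IsColoring c' e' θ') :
    D.IsColoring (c + c') (e + e') (θ + θ') where
  edge d := by simp only [Pi.add_apply, h.edge, h'.edge]; abel
  subdivision d hd := by simp only [Pi.add_apply, h.subdivision d hd, h'.subdivision d hd]; abel
  overpass d hd ho := by simp only [Pi.add_apply, h.overpass d hd ho, h'.overpass d hd ho]; abel
  crossing d hd := by
    refine Eq.trans ?_
      ((congrArg₂ (· + ·) (h.crossing d hd) (h'.crossing d hd)).trans (add_zero 0))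
    simp only [Pi.add_apply]
    abel

theorem IsColoring.neg (h : D.IsColoring c e θ) : D.IsColoring (-c) (-e) (-θ) where
  edge d := by simp only [Pi.neg_apply, h.edge]; abel
  subdivision d hd := by simp only [Pi.neg_apply, h.subdivision d hd]; abel
  overpass d hd ho := by simp only [Pi.neg_apply, h.overpass d hd ho]; abel
  crossing d hd := by
    rw [← neg_zero (G := T), ← h.crossing d hd]
    simp only [Pi.neg_apply]
    abel

variable (D T) in
/-- The homogeneous colorings. -/
def homogeneousColorings : AddSubgroup (D.Dart → T) where
  carrier := {θ | D.IsColoring 0 0 θ}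
  zero_mem' := ⟨by simp, by simp, by simp, by simp⟩
  add_mem' h h' := by simpa using IsColoring.add h h'
  neg_mem' h := by simpa using IsColoring.neg h

variable (D T) in
/-- The colorings modulo constants. -/
abbrev ColoringClasses : Type _ :=
  homogeneousColorings D T ⧸
    ((Pi.constAddMonoidHom D.Dart T).range.addSubgroupOf (homogeneousColorings D T))

end IsColoring

/-- If the determinant does not vanish, there are finitely many classes of colorings. -/
theorem finite_coloringClasses (hdet : D.determinant ≠ 0) :
    Finite (ColoringClasses D Real.Angle) := by
  rcases isEmpty_or_nonempty D.Dart with hX | hX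
  · exact Quotient.finite _
  obtain ⟨d₀, t, ht, h⟩ := D.exists_smul_eq_zero_of_isColoring hdet
  have htor : {a : Real.Angle | t • a = 0}.Finite := by
    refine (Set.finite_range fun k : Fin t.natAbs =>
      (0 : Real.Angle) + (k : ℕ) • ((2 * Real.pi / t : ℝ) : Real.Angle)).subset ?_
    intro a ha
    obtain ⟨k, hk⟩ := (Real.Angle.zsmul_eq_iff (ψ := a) (θ := 0) ht).mp (by rw [ha, smul_zero])
    exact ⟨k, hk.symm⟩
  have hfin : {θ : D.Dart → Real.Angle | ∀ d, t • θ d = 0}.Finite := by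
    refine (Set.Finite.pi' fun _ => htor).subset fun θ hθ => hθ
  -- Every class has a representative that vanishes at `d₀`. Its values are killed by `t`, and the
  -- circle has finitely many such elements.
  let S : Set (homogeneousColorings D Real.Angle) := {θ | θ.1 d₀ = 0}
  have hS : Finite S := by
    refine Set.Finite.to_subtype (Set.Finite.of_finite_image (f := Subtype.val)
      (hfin.subset ?_) Subtype.val_injective.injOn)
    rintro _ ⟨θ, hθ, rfl⟩
    exact h _ θ.1 θ.2 hθ
  refine Finite.of_surjective
    (fun θ : S => (QuotientAddGroup.mk θ.1 : ColoringClasses D Real.Angle))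
    fun q => ?_
  obtain ⟨θ, rfl⟩ := QuotientAddGroup.mk_surjective q
  have hconst : D.IsColoring 0 0 (fun _ => -θ.1 d₀) := ⟨by simp, by simp, by simp, by simp⟩
  refine ⟨⟨θ + ⟨fun _ => -θ.1 d₀, hconst⟩, add_neg_cancel _⟩, ?_⟩
  refine QuotientAddGroup.eq.mpr (AddSubgroup.mem_addSubgroupOf.mpr ⟨θ.1 d₀, ?_⟩)
  ext1 d
  change θ.1 d₀ = -(θ.1 d + -θ.1 d₀) + θ.1 d
  abel

section Iso

variable {D' : MarkedLinkDiagram}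

theorem Iso.isCrossing_iff (ι : D.Iso D') (d : D.Dart) :
    D'.IsCrossing (ι.toEquiv d) ↔ D.IsCrossing d := by
  simp only [IsCrossing, ← ι.map_rot, ne_eq, EmbeddingLike.apply_eq_iff_eq]

theorem Iso.isSubdivision_iff (ι : D.Iso D') (d : D.Dart) :
    D'.IsSubdivision (ι.toEquiv d) ↔ D.IsSubdivision d := by
  simp only [IsSubdivision, ← ι.map_rot, ne_eq, EmbeddingLike.apply_eq_iff_eq]

/-- The identity isomorphism. -/
def Iso.refl (D : MarkedLinkDiagram) : D.Iso D where
  toEquiv := Equiv.refl _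
  map_edge _ := rfl
  map_rot _ := rfl
  map_isLink _ := Iff.rfl
  map_isOver _ _ := Iff.rfl

/-- The inverse isomorphism. -/
def Iso.symm (ι : D.Iso D') : D'.Iso D where
  toEquiv := ι.toEquiv.symm
  map_edge d := by rw [Equiv.symm_apply_eq, ι.map_edge, Equiv.apply_symm_apply]
  map_rot d := by rw [Equiv.symm_apply_eq, ι.map_rot, Equiv.apply_symm_apply]
  map_isLink d := by rw [← ι.map_isLink, Equiv.apply_symm_apply]
  map_isOver d hd := by
    rw [← ι.map_isOver, Equiv.apply_symm_apply]
    rw [← ι.isCrossing_iff, Equiv.apply_symm_apply]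
    exact hd

theorem IsColoring.comp_iso {T : Type*} [AddCommGroup T] {c : T} {e θ : D'.Dart → T}
    (h : D'.IsColoring c e θ) (ι : D.Iso D') :
    D.IsColoring c (e ∘ ι.toEquiv) (θ ∘ ι.toEquiv) where
  edge d := by simp only [Function.comp_apply, ι.map_edge, h.edge]
  subdivision d hd := by
    simp only [Function.comp_apply, ι.map_rot]
    exact h.subdivision _ ((ι.isSubdivision_iff d).mpr hd)
  overpass d hd ho := by
    simp only [Function.comp_apply, ι.map_rot]
    exact h.overpass _ ((ι.isCrossing_iff d).mpr hd) ((ι.map_isOver d hd).mpr ho)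
  crossing d hd := by
    simp only [Function.comp_apply, ι.map_rot]
    exact h.crossing _ ((ι.isCrossing_iff d).mpr hd)

end Iso

theorem IsEndpoint.isLink_rot_rot_iff {d : D.Dart} (h : D.IsEndpoint d) (hl : D.isLink d) :
    D.isLink (D.rot (D.rot d)) ↔ ¬ D.isLink (D.rot d) := by
  have := h.isLink_cases
  tauto

theorem IsEndpoint.isLink_rot {d : D.Dart} (h : D.IsEndpoint d) (hl : ¬ D.isLink d) :
    D.isLink (D.rot d) ∧ D.isLink (D.rot (D.rot d)) := by
  have := h.isLink_cases
  tauto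

theorem isEndpoint_rot_iff (d : D.Dart) : D.IsEndpoint (D.rot d) ↔ D.IsEndpoint d := by
  refine ⟨fun h => ⟨fun h' => h.1 (congrArg D.rot h'), D.rot.injective h.2⟩, IsEndpoint.rot⟩

variable (D) in
/-- The number of end points of `ω` is even, and each of them is on two edges of `L`. -/
theorem four_dvd_card_isEndpoint : 4 ∣ Nat.card {d : D.erase.Dart // D.IsEndpoint d.1} := by
  classical
  let : Fintype D.Dart := Fintype.ofFinite _
  have hcard : Nat.card {d : D.erase.Dart // D.IsEndpoint d.1} =
      (Finset.univ.filter fun d : D.Dart => D.isLink d ∧ D.IsEndpoint d).card := by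
    rw [← Fintype.card_subtype, ← Nat.card_eq_fintype_card]
    exact Nat.card_congr (Equiv.subtypeSubtypeEquivSubtypeInter _ _)
  rw [hcard, ← ZMod.natCast_eq_zero_iff, Finset.natCast_card_filter]
  let w : D.Dart → ZMod 4 := fun d => if ¬ D.isLink d ∧ D.IsEndpoint d then 1 else 0
  -- Around an end point, a dart of `L` sees the dart of `ω` after one or two rotations, but not
  -- after both, and the dart of `ω` sees none. Thus the count is twice the number of darts of `ω`
  -- at end points.
  have hw : ∀ d, (if D.isLink d ∧ D.IsEndpoint d then (1 : ZMod 4) else 0) =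
      w (D.rot d) + w (D.rot (D.rot d)) := by
    intro d
    by_cases he : D.IsEndpoint d
    · by_cases hl : D.isLink d
      · by_cases hr : D.isLink (D.rot d) <;>
          simp [w, he, hl, hr, isEndpoint_rot_iff, he.isLink_rot_rot_iff hl]
      · simp [w, he, hl, isEndpoint_rot_iff, he.isLink_rot hl]
    · simp [w, he, isEndpoint_rot_iff]
  have h2 : (2 : ZMod 4) + 2 = 0 := by decide
  -- The number of darts of `ω` is even because `edge` pairs them; those away from the end points
  -- are paired by `turn`. So the number of darts of `ω` at end points is even.
  have hω : ∑ d with ¬ D.isLink d, (2 : ZMod 4) = 0 :=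
    Finset.sum_involution (fun d _ => D.edge d) (fun _ _ => h2) (fun d _ _ => D.edge_ne d)
      (fun d hd => by simpa [D.isLink_edge] using hd) (fun d _ => D.edge_edge d)
  have hω' : ∑ d with ¬ D.isLink d ∧ ¬ D.IsEndpoint d, (2 : ZMod 4) = 0 := by
    have hcases : ∀ d, ¬ D.isLink d ∧ ¬ D.IsEndpoint d → D.turn d ≠ d ∧ D.turn (D.turn d) = d ∧
        ¬ D.isLink (D.turn d) ∧ ¬ D.IsEndpoint (D.turn d) := by
      rintro d ⟨hl, he⟩
      rcases D.isSubdivision_or_isEndpoint_or_isCrossing d with h | h | h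
      · rw [h.turn_eq, h.rot.turn_eq, h.isLink_rot_iff, isEndpoint_rot_iff]
        exact ⟨h.1, h.2, hl, he⟩
      · exact absurd h he
      · rw [h.turn_eq, h.rot.rot.turn_eq, h.isLink_rot_rot_iff, isEndpoint_rot_iff,
          isEndpoint_rot_iff]
        exact ⟨h.1, h.2, hl, he⟩
    refine Finset.sum_involution (fun d _ => D.turn d) (fun _ _ => h2) ?_ ?_ ?_
    · exact fun d hd _ => (hcases d (Finset.mem_filter.mp hd).2).1
    · exact fun d hd => Finset.mem_filter.mpr
        ⟨Finset.mem_univ _, (hcases d (Finset.mem_filter.mp hd).2).2.2⟩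
    · exact fun d hd => (hcases d (Finset.mem_filter.mp hd).2).2.1
  have hsplit : ∑ d, (w d + w d) = ∑ d with ¬ D.isLink d, (2 : ZMod 4) -
      ∑ d with ¬ D.isLink d ∧ ¬ D.IsEndpoint d, (2 : ZMod 4) := by
    rw [Finset.sum_filter, Finset.sum_filter, ← Finset.sum_sub_distrib]
    refine Finset.sum_congr rfl fun d _ => ?_
    by_cases hl : D.isLink d <;> by_cases he : D.IsEndpoint d <;> simp [w, hl, he]
    norm_num
  simp only [hw]
  rw [Finset.sum_add_distrib, Equiv.sum_comp D.rot w, Equiv.sum_comp D.rot (fun d => w (D.rot d)),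
    Equiv.sum_comp D.rot w, ← Finset.sum_add_distrib, hsplit, hω, hω', sub_zero]

/-- The classes of marked binary dihedral representations correspond to those of the homogeneous
colorings of the diagram of the link, which do not depend on the marking. -/
theorem nonempty_RB_equiv {E : MarkedLinkDiagram} (hE : ∀ d, E.isLink d)
    (hdet : E.determinant ≠ 0) {σ : E.Dart → ℤˣ}
    (hσ : ∀ d, σ (E.edge d) = -σ d ∧ σ (E.rot d) = -σ d) (ι : E.Iso D.erase) :
    Nonempty (D.RB ≃ ColoringClasses E Real.Angle) := by
  classical
  have hsub : ∀ d : E.Dart, D.IsEndpoint (ι.toEquiv d).1 → E.IsSubdivision d := fun d hd =>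
    (ι.isSubdivision_iff d).mp (isSubdivision_erase_of_isEndpoint hd)
  obtain ⟨θ, hθ⟩ : ∃ θ, D.erase.IsColoring (Real.pi : Real.Angle) D.endpointShift θ := by
    obtain ⟨θ, hθ⟩ := E.exists_isColoring hE hdet hσ (p := fun d => D.IsEndpoint (ι.toEquiv d).1)
      (fun d hd => by
        rw [ι.map_rot]
        by_cases hl : D.isLink (D.rot (ι.toEquiv d).1)
        · rw [coe_erase_rot_of_isLink hl, isEndpoint_rot_iff]
        · rw [coe_erase_rot_of_not_isLink hl, isEndpoint_rot_iff, isEndpoint_rot_iff])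
      (by
        rw [Nat.card_congr (ι.toEquiv.subtypeEquiv (q := fun d => D.IsEndpoint d.1) fun d =>
          ⟨fun h => h.2, fun h => ⟨hsub d h, h⟩⟩)]
        exact D.four_dvd_card_isEndpoint)
    have hshift : (fun d => if D.IsEndpoint (ι.toEquiv d).1 then (0 : Real.Angle) else Real.pi) ∘
        ι.symm.toEquiv = D.endpointShift := by
      ext1 d
      change (if D.IsEndpoint (ι.toEquiv (ι.toEquiv.symm d)).1 then _ else _) = _
      rw [Equiv.apply_symm_apply]
      exact if_congr Iff.rfl rfl rfl
    exact ⟨_, hshift ▸ hθ.comp_iso ι.symm⟩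
  -- Subtracting the particular solution `θ` removes all constants, and with them the dependence on
  -- the marking.
  let F (ρ : D.RepB) : homogeneousColorings E Real.Angle :=
    ⟨(ρ.angle + -θ) ∘ ι.toEquiv, by
      have := (ρ.isColoring_angle.add hθ.neg).comp_iso ι
      rwa [add_neg_cancel, add_neg_cancel] at this⟩
  have hF : ∀ ρ ρ', (QuotientAddGroup.mk (F ρ) : ColoringClasses E Real.Angle) =
      QuotientAddGroup.mk (F ρ') ↔ D.repBSetoid ρ ρ' := by
    intro ρ ρ'
    rw [QuotientAddGroup.eq, AddSubgroup.mem_addSubgroupOf, repBSetoid_iff]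
    have key : ∀ d, ((-F ρ + F ρ' : homogeneousColorings E Real.Angle) : E.Dart → Real.Angle) d =
        ρ'.angle (ι.toEquiv d) - ρ.angle (ι.toEquiv d) := by
      intro d
      change -(ρ.angle (ι.toEquiv d) + -θ (ι.toEquiv d)) +
        (ρ'.angle (ι.toEquiv d) + -θ (ι.toEquiv d)) = _
      abel
    constructor
    · rintro ⟨a, ha⟩
      refine ⟨a, fun d => ?_⟩
      obtain ⟨d, rfl⟩ := ι.toEquiv.surjective d
      rw [← key, ← ha]
      rfl
    · rintro ⟨a, ha⟩
      refine ⟨a, ?_⟩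
      ext1 d
      rw [key, ha]
      rfl
  refine ⟨Equiv.ofBijective (Quotient.lift (fun ρ => (QuotientAddGroup.mk (F ρ) :
    ColoringClasses E Real.Angle)) fun ρ ρ' h => (hF ρ ρ').mpr h) ⟨?_, ?_⟩⟩
  · intro q q'
    induction q using Quotient.inductionOn with | _ ρ =>
    induction q' using Quotient.inductionOn with | _ ρ' =>
    exact fun h => Quotient.sound ((hF ρ ρ').mp h)
  · intro q
    obtain ⟨η, rfl⟩ := QuotientAddGroup.mk_surjective q
    -- Conversely, adding `θ` to a homogeneous coloring gives the angles of a marked representation.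
    have hη : D.erase.IsColoring (Real.pi : Real.Angle) D.endpointShift
        (η.1 ∘ ι.toEquiv.symm + θ) := by
      have := (IsColoring.comp_iso η.2 ι.symm).add hθ
      rwa [zero_add, Pi.zero_comp, zero_add] at this
    refine ⟨Quotient.mk _ hη.toRepB, ?_⟩
    refine congrArg QuotientAddGroup.mk (Subtype.ext ?_)
    ext1 d
    change hη.toRepB.angle (ι.toEquiv d) + -θ (ι.toEquiv d) = η.1 d
    rw [hη.angle_toRepB]
    simp

end MarkedLinkDiagram

/-- `D` and `D'` are diagrams of `(L, ω)` and `(L, ω')` for the same link `L`: erasing the markings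
leaves the same diagram of `L` (subdivision points can be added to `D` and `D'` at will, so that
those left behind by `ω` and `ω'` are no restriction). -/
theorem mainTheorem7 (D D' : MarkedLinkDiagram) (hD : D.IsPlanar) (hD' : D'.IsPlanar)
    (sameLink : D.erase.Iso D'.erase) (hdet : D.erase.determinant ≠ 0) :
    Finite D.RB ∧ Finite D'.RB ∧ Nat.card D.RB = Nat.card D'.RB := by
  obtain ⟨σ, hσ⟩ := D.exists_alternating_erase hD
  have hE : ∀ d, D.erase.isLink d := fun _ => trivial
  -- Both sets are compared with the coloring classes of the same diagram `D.erase`, equipped with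
  -- the same signs `σ`.
  obtain ⟨f⟩ := MarkedLinkDiagram.nonempty_RB_equiv hE hdet hσ (MarkedLinkDiagram.Iso.refl _)
  obtain ⟨f'⟩ := MarkedLinkDiagram.nonempty_RB_equiv hE hdet hσ sameLink
  have := MarkedLinkDiagram.finite_coloringClasses hdet
  exact ⟨Finite.of_equiv _ f.symm, Finite.of_equiv _ f'.symm, Nat.card_congr (f.trans f'.symm)⟩
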